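/- Let $d\ge 1$, let $\Omega$ be the uniform ensemble (the unitarily invariant probability measure on the unit vectors $\psi\in\mathbb C^d$), and let $dU$ be the normalized Haar measure on $U(d)$. Definitions. A POVM on a measurable outcome space $X$ is given by a $\sigma$-finite measure $\nu$ on $X$ and a measurable family of positive operators $F_x$ on $\mathbb C^d$ with $\int F_x\,d\nu(x)=I$ (finite POVMs are the case of counting measure on a finite set). An operation $\mathcal A(\rho)=\sum_i A_i\rho A_i^\dagger$ (finite sum) is compatible with the effect $\sum_i A_i^\dagger A_i$. An instrument for $(F_x,\nu)$ is a measurable family of operations $\mathcal A_x$, each compatible with $F_x$; the pair is called a procedure, and its overall operation is $\mathcal A(\rho)=\int\mathcal A_x(\rho)\,d\nu(x)$. Its disturbance is $$\overline D=1-\int d\Omega(\psi)\int d\nu(x)\,F\big(|\psi\rangle\langle\psi|,\mathcal A_x(|\psi\rangle\langle\psi|)\big),\qquad F(\rho,\sigma)=\Big(\operatorname{tr}\sqrt{\rho^{1/2}\sigma\rho^{1/2}}\Big)^2 .$$ Its information gain $I$ is the mutual information between $\psi\sim\Omega$ and the outcome: with $p(x|\psi)=\langle\psi|F_x|\psi\rangle$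 and $p(x)=\int p(x|\psi)\,d\Omega(\psi)$, $$I=\int d\Omega(\psi)\int d\nu(x)\,p(x|\psi)\log\frac{p(x|\psi)}{p(x)} .$$ The square-root dynamics of a POVM is the instrument $\mathcal A_x(\rho)=F_x^{1/2}\rho F_x^{1/2}$. The Haar twirl of $(F_x,\nu)$ is the POVM on $X\times U(d)$ with reference measure $d\nu(x)\,dU$ and effects $UF_xU^\dagger$. An operation $\mathcal A$ is unitarily covariant if $W^\dagger\mathcal A(W\rho W^\dagger)W=\mathcal A(\rho)$ for all unitary $W$ and all operators $\rho$. For real $p$ let $\mathcal A_p(\rho)=(1-p)\rho+p\,(\operatorname{tr}\rho)\,I/d$. Theorem. 1. For every procedure, with information gain $I$ say, there is a finite POVM $\{G_b\}$ such that the Haar twirl of $\{G_b\}$ with its square-root dynamics is a procedure which has information gain $I$, whose disturbance is at most that of every procedure with information gain $I$, and whose overall operation is unitarily covariant and equal to $\mathcal A_p$ for some $p\in[0,1]$. 2. For every POVM $(F_x,\nu)$, the Haar twirl with its square-root dynamics is a procedure with the same information gain as $(F_x,\nu)$. Its disturbance is the minimum of the disturbances of all instruments for $(F_x,\nu)$,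 and also the minimum of the disturbances of all instruments for the twirled POVM. Its overall operation is unitarily covariant and equal to $\mathcal A_p$ for some $p\in[0,1]$. 3. For a finite POVM the information gain equals $H(B)-H(B|\Psi)$, where $H(B)=-\sum_b p(b)\log p(b)$ and $H(B|\Psi)=-\int d\Omega(\psi)\sum_b p(b|\psi)\log p(b|\psi)$. 4. A trace-preserving completely positive map $\mathcal A$ on the operators of $\mathbb C^d$ is unitarily covariant if and only if $\mathcal A=\mathcal A_p$ for some real $p\ge 0$ with $p(d^2-1)\le d^2$. -/

import Mathlib

open MeasureTheory Matrix
open scoped ComplexOrder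

noncomputable section

namespace QuantumMeasurement

/-- Linear operators on the Hilbert space `ℂ ^ d`. -/
abbrev Op (d : ℕ) : Type := Matrix (Fin d) (Fin d) ℂ

/-- The unitary group `U(d)`, with the topology of matrices. -/
abbrev UGroup (d : ℕ) : Type := Matrix.unitaryGroup (Fin d) ℂ

instance instCompactSpaceUGroup (d : ℕ) : CompactSpace (UGroup d) := by
  have hc : IsClosed ((Matrix.unitaryGroup (Fin d) ℂ : Set (Op d))) := isClosed_unitary
  have hK : IsCompact ({A : Fin d → Fin d → ℂ | ∀ i, A i ∈
      {v : Fin d → ℂ | ∀ j, v j ∈ Metric.closedBall (0 : ℂ) 1}}) :=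
    isCompact_pi_infinite fun _ =>
      isCompact_pi_infinite fun _ => isCompact_closedBall (0 : ℂ) 1
  refine isCompact_iff_compactSpace.mp (IsCompact.of_isClosed_subset hK hc ?_)
  intro A hA i j
  simpa using entry_norm_bound_of_unitary hA i j

/-- `U(d)` carries its Borel sigma-algebra. -/
instance instMeasurableSpaceUGroup (d : ℕ) : MeasurableSpace (UGroup d) := borel _

instance instBorelSpaceUGroup (d : ℕ) : BorelSpace (UGroup d) := ⟨rfl⟩

/-- Haar measure on `U(d)`, normalized to total mass `1`. -/
def haarU (d : ℕ) : Measure (UGroup d) :=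
  Measure.haarMeasure (⊤ : TopologicalSpace.PositiveCompacts (UGroup d))

/-- The uniform ensemble `Ω`: the unitarily invariant probability measure on the unit vectors of
`ℂ ^ d`, that is, the law of `U e₀` for a Haar distributed unitary `U`. -/
def uniformEnsemble (d : ℕ) [NeZero d] : Measure (Fin d → ℂ) :=
  Measure.map (fun U : UGroup d => (U : Op d) *ᵥ Pi.single 0 1) (haarU d)

/-- The operator `|ψ⟩⟨ψ|`. -/
def ketbra {d : ℕ} (ψ : Fin d → ℂ) : Op d := Matrix.vecMulVec ψ (star ψ)

/-- The positive square root of a positive operator (continuous functional calculus). -/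
def sqrtOp {d : ℕ} (A : Op d) : Op d := cfc Real.sqrt A

/-- The fidelity `(tr √(ρ^{1/2} σ ρ^{1/2}))²`; the second argument may be unnormalized. -/
def fidelity {d : ℕ} (ρ σ : Op d) : ℝ :=
  (sqrtOp (sqrtOp ρ * σ * sqrtOp ρ)).trace.re ^ 2

/-- The integral of an operator valued function, entry by entry. -/
def opIntegral {d : ℕ} {X : Type*} [MeasurableSpace X] (ν : Measure X) (F : X → Op d) : Op d :=
  Matrix.of fun i j => ∫ x, F x i j ∂ν

/-- The infinitesimal effects `F x dν(x)` form a POVM on the outcome space `X`: the effect of a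
measurable set `Δ` of outcomes is `∫_Δ F dν`. Discrete POVMs are the case where `ν` is the
counting measure. -/
structure IsPOVM {d : ℕ} {X : Type*} [MeasurableSpace X] (ν : Measure X) (F : X → Op d) :
    Prop where
  measurable : ∀ i j, Measurable fun x => F x i j
  posSemidef : ∀ x, (F x).PosSemidef
  integrable : ∀ i j, Integrable (fun x => F x i j) ν
  integral_eq_one : opIntegral ν F = 1

/-- The operators `A i` form a Hellwig-Kraus decomposition of the operation `𝒜`. -/
def IsKrausDecomposition {d : ℕ} {ι : Type*} [Fintype ι] (A : ι → Op d) (𝒜 : Op d → Op d) :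
    Prop :=
  ∀ ρ, 𝒜 ρ = ∑ i, A i * ρ * (A i)ᴴ

/-- The operation `𝒜` is compatible with the effect `E`. -/
def IsCompatible {d : ℕ} (E : Op d) (𝒜 : Op d → Op d) : Prop :=
  ∃ (r : ℕ) (A : Fin r → Op d), IsKrausDecomposition A 𝒜 ∧ ∑ i, (A i)ᴴ * A i = E

/-- A trace-preserving completely positive map. -/
def IsChannel {d : ℕ} (𝒜 : Op d → Op d) : Prop := IsCompatible 1 𝒜

/-- A measurement procedure: a POVM `F x dν(x)` together with a compatible instrument
`𝒜 x dν(x)`. -/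
structure IsProcedure {d : ℕ} {X : Type*} [MeasurableSpace X] (ν : Measure X) (F : X → Op d)
    (𝒜 : X → Op d → Op d) : Prop where
  povm : IsPOVM ν F
  measurable : ∀ ρ i j, Measurable fun x => 𝒜 x ρ i j
  compatible : ∀ x, IsCompatible (F x) (𝒜 x)

/-- The overall operation `ρ ↦ ∫ 𝒜 x ρ dν(x)`, the outcome being ignored. -/
def overallOperation {d : ℕ} {X : Type*} [MeasurableSpace X] (ν : Measure X)
    (𝒜 : X → Op d → Op d) : Op d → Op d :=
  fun ρ => opIntegral ν fun x => 𝒜 x ρ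

/-- The average disturbance to the uniform ensemble: one minus the fidelity of the input to the
conditional outputs, averaged over inputs and outcomes. -/
def disturbance {d : ℕ} [NeZero d] {X : Type*} [MeasurableSpace X] (ν : Measure X)
    (𝒜 : X → Op d → Op d) : ℝ :=
  1 - ∫ ψ, (∫ x, fidelity (ketbra ψ) (𝒜 x (ketbra ψ)) ∂ν) ∂(uniformEnsemble d)

/-- The outcome probability (density) `tr (E |ψ⟩⟨ψ|) = ⟨ψ|E|ψ⟩` given the input `ψ`. -/
def condProb {d : ℕ} (E : Op d) (ψ : Fin d → ℂ) : ℝ := (E * ketbra ψ).trace.re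

/-- The outcome probability (density) for a random input from the uniform ensemble. -/
def meanProb {d : ℕ} [NeZero d] (E : Op d) : ℝ := ∫ ψ, condProb E ψ ∂(uniformEnsemble d)

/-- The information gain: the mutual information of the input `Ψ` (uniform ensemble) and the
outcome `B`, `∫∫ p(x|ψ) log (p(x|ψ) / p(x)) dν(x) dΩ(ψ)`. -/
def information {d : ℕ} [NeZero d] {X : Type*} [MeasurableSpace X] (ν : Measure X)
    (F : X → Op d) : ℝ :=
  ∫ ψ, (∫ x, condProb (F x) ψ * Real.log (condProb (F x) ψ / meanProb (F x)) ∂ν)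
    ∂(uniformEnsemble d)

/-- `H(B)`, for a finite POVM. -/
def outcomeEntropy {d : ℕ} [NeZero d] {ι : Type*} [Fintype ι] (F : ι → Op d) : ℝ :=
  ∑ b, Real.negMulLog (meanProb (F b))

/-- `H(B|Ψ)`, for a finite POVM. -/
def condOutcomeEntropy {d : ℕ} [NeZero d] {ι : Type*} [Fintype ι] (F : ι → Op d) : ℝ :=
  ∫ ψ, (∑ b, Real.negMulLog (condProb (F b) ψ)) ∂(uniformEnsemble d)

/-- The square-root dynamics of a POVM. -/
def sqrtDynamics {d : ℕ} {X : Type*} (F : X → Op d) : X → Op d → Op d :=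
  fun x ρ => sqrtOp (F x) * ρ * sqrtOp (F x)

/-- The effects of the Haar twirl of a POVM: the outcomes are pairs `(x, U)`, the effects are
`U F_x U† dν(x) dU`. -/
def twirl {d : ℕ} {X : Type*} (F : X → Op d) : X × UGroup d → Op d :=
  fun y => (y.2 : Op d) * F y.1 * (y.2 : Op d)ᴴ

/-- The reference measure `dν(x) dU` of the Haar twirl. -/
def twirlMeasure (d : ℕ) {X : Type*} [MeasurableSpace X] (ν : Measure X) :
    Measure (X × UGroup d) :=
  ν.prod (haarU d)

/-- `W† 𝒜(W ρ W†) W = 𝒜(ρ)` for all unitaries `W` and all `ρ`. -/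
def IsUnitarilyCovariant {d : ℕ} (𝒜 : Op d → Op d) : Prop :=
  ∀ (W : UGroup d) (ρ : Op d),
    (W : Op d)ᴴ * 𝒜 ((W : Op d) * ρ * (W : Op d)ᴴ) * (W : Op d) = 𝒜 ρ

/-- The linear extension of `ρ ↦ (1 - p) ρ + p I / d` from density operators to all operators. -/
def depolarizing {d : ℕ} (p : ℝ) : Op d → Op d :=
  fun ρ => ((1 - p : ℝ) : ℂ) • ρ + ((p / d : ℝ) * ρ.trace) • (1 : Op d)

end QuantumMeasurement

end

open QuantumMeasurement

namespace QuantumMeasurement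

variable {d : ℕ}

/-! ### Square roots of positive operators. -/

section SquareRoot

/-! Disturbance and information are both integrals over outcomes of a function of a single effect,
and the whole argument studies these two functions.

For a unit vector the fidelity is `⟨ψ|σ|ψ⟩`, so the mean fidelity of an operation with Kraus
operators `A i` is a second moment of the uniform ensemble. That moment map commutes with unitary
conjugation, hence sends `A` to a combination of `A` and `tr A • 1`, and exchange symmetry fixes the
constants (`momentMap_eq`). The mean fidelity becomes `(tr E + ∑ |tr A i|²) / (d (d + 1))` with `E`
the effect (`IsKrausDecomposition.integral_fidelity`). Minkowski's inequality in an eigenbasis of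
`E` bounds `∑ |tr A i|²` by `(tr √E)²` (`sum_normSq_trace_le`), with equality for the single Kraus
operator `√E`. So the least disturbance for a POVM is `1 - ∫ optimalFidelity (F x)`, reached by the
square-root dynamics. The information is `∫ infoDensity (F x)`. Both densities are invariant under
unitary conjugation, so the Haar twirl changes neither integral.

Both densities are also homogeneous of degree one, so the pair (information, optimal fidelity) of a
POVM, divided by `d`, is an average over a compact planar set, the image of the simplex of
normalized spectra, and lies in its convex hull (`IsPOVM.integral_infoFidelity_mem`). Conversely
each point of the hull comes from a finite POVM built from cyclic shifts of diagonal operators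
(`exists_povm_of_mem_convexHull`). The hull is compact, so at fixed information the largest fidelity
is attained.

Left invariance of Haar measure makes the overall operation covariant. A covariant linear map has
the form `a • ρ + b tr ρ • 1` (`exists_eq_of_covariant`). Trace preservation and the value of `s = ∑
|tr A k|²` (an integral of `(tr √F)²` for the square-root dynamics) then determine `p` through `p
(d² - 1) = d² - s`, up to the degenerate case `d = 1`; bounds on `s` give the range of `p`. -/

/-- The spectrum of `B` is nonnegative, so `√(x²) = x` on it. This uniqueness is how every square
root below is computed. -/
theorem sqrtOp_eq_of_mul_self {A B : Op d} (hB : B.PosSemidef) (h : B * B = A) :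
    sqrtOp A = B := by
  have hs : IsSelfAdjoint B := hB.isHermitian
  have h2 : A = cfc (fun x : ℝ => x ^ 2) B := by rw [cfc_pow_id B 2, sq, h]
  have hspec : ∀ x ∈ spectrum ℝ B, 0 ≤ x := by
    intro x hx
    rw [hB.isHermitian.spectrum_real_eq_range_eigenvalues] at hx
    obtain ⟨i, rfl⟩ := hx
    exact hB.eigenvalues_nonneg i
  rw [sqrtOp, h2, ← cfc_comp' Real.sqrt (fun x : ℝ => x ^ 2) B]
  conv_rhs => rw [← cfc_id ℝ B]
  exact cfc_congr fun x hx => by simp [Real.sqrt_sq (hspec x hx)]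

theorem exists_diagonalization {A : Op d} (hA : A.PosSemidef) :
    ∃ (V : UGroup d) (l : Fin d → ℝ), (∀ i, 0 ≤ l i) ∧
      A = (V : Op d) * diagonal (fun i => (l i : ℂ)) * (V : Op d)ᴴ := by
  refine ⟨hA.isHermitian.eigenvectorUnitary, hA.isHermitian.eigenvalues, hA.eigenvalues_nonneg, ?_⟩
  have := hA.isHermitian.spectral_theorem
  simpa [Unitary.conjStarAlgAut_apply, Function.comp_def, star_eq_conjTranspose] using this

theorem conjTranspose_mul_coe (V : UGroup d) : (V : Op d)ᴴ * (V : Op d) = 1 :=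
  Unitary.coe_star_mul_self V

theorem coe_mul_conjTranspose (V : UGroup d) : (V : Op d) * (V : Op d)ᴴ = 1 :=
  Unitary.coe_mul_star_self V

theorem conj_mul_conj (V : UGroup d) (A B : Op d) :
    ((V : Op d) * A * (V : Op d)ᴴ) * ((V : Op d) * B * (V : Op d)ᴴ) =
      (V : Op d) * (A * B) * (V : Op d)ᴴ := by
  calc _ = (V : Op d) * A * ((V : Op d)ᴴ * (V : Op d)) * B * (V : Op d)ᴴ := by
        simp only [Matrix.mul_assoc]
    _ = _ := by rw [conjTranspose_mul_coe]; simp only [Matrix.mul_assoc, Matrix.mul_one]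

theorem trace_conj (V : UGroup d) (A : Op d) :
    ((V : Op d) * A * (V : Op d)ᴴ).trace = A.trace := by
  rw [Matrix.trace_mul_cycle, conjTranspose_mul_coe, Matrix.one_mul]

theorem posSemidef_diagonal_ofReal {l : Fin d → ℝ} (hl : ∀ i, 0 ≤ l i) :
    (diagonal (fun i => (l i : ℂ))).PosSemidef :=
  PosSemidef.diagonal fun i => by simpa using hl i

theorem sqrtOp_diagonal {l : Fin d → ℝ} (hl : ∀ i, 0 ≤ l i) :
    sqrtOp (diagonal (fun i => (l i : ℂ))) = diagonal (fun i => (Real.sqrt (l i) : ℂ)) := by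
  refine sqrtOp_eq_of_mul_self (posSemidef_diagonal_ofReal fun i => Real.sqrt_nonneg _) ?_
  rw [diagonal_mul_diagonal]
  congr 1
  ext i
  rw [← Complex.ofReal_mul, Real.mul_self_sqrt (hl i)]

theorem posSemidef_conj (V : UGroup d) {A : Op d} (hA : A.PosSemidef) :
    ((V : Op d) * A * (V : Op d)ᴴ).PosSemidef :=
  hA.mul_mul_conjTranspose_same _

theorem posSemidef_sqrtOp_and_mul_self {A : Op d} (hA : A.PosSemidef) :
    (sqrtOp A).PosSemidef ∧ sqrtOp A * sqrtOp A = A := by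
  obtain ⟨V, l, hl, rfl⟩ := exists_diagonalization hA
  have hS : sqrtOp ((V : Op d) * diagonal (fun i => (l i : ℂ)) * (V : Op d)ᴴ) =
      (V : Op d) * diagonal (fun i => (Real.sqrt (l i) : ℂ)) * (V : Op d)ᴴ := by
    refine sqrtOp_eq_of_mul_self (posSemidef_conj _
      (posSemidef_diagonal_ofReal fun i => Real.sqrt_nonneg _)) ?_
    rw [conj_mul_conj, diagonal_mul_diagonal]
    congr 3
    ext i
    rw [← Complex.ofReal_mul, Real.mul_self_sqrt (hl i)]
  rw [hS]
  refine ⟨posSemidef_conj _ (posSemidef_diagonal_ofReal fun i => Real.sqrt_nonneg _), ?_⟩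
  rw [conj_mul_conj, diagonal_mul_diagonal]
  congr 3
  ext i
  rw [← Complex.ofReal_mul, Real.mul_self_sqrt (hl i)]

theorem posSemidef_sqrtOp {A : Op d} (hA : A.PosSemidef) : (sqrtOp A).PosSemidef :=
  (posSemidef_sqrtOp_and_mul_self hA).1

theorem sqrtOp_mul_self {A : Op d} (hA : A.PosSemidef) : sqrtOp A * sqrtOp A = A :=
  (posSemidef_sqrtOp_and_mul_self hA).2

theorem sqrtOp_conj (V : UGroup d) {A : Op d} (hA : A.PosSemidef) :
    sqrtOp ((V : Op d) * A * (V : Op d)ᴴ) = (V : Op d) * sqrtOp A * (V : Op d)ᴴ := by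
  refine sqrtOp_eq_of_mul_self (posSemidef_conj _ (posSemidef_sqrtOp hA)) ?_
  rw [conj_mul_conj, sqrtOp_mul_self hA]

theorem sqrtOp_smul {c : ℝ} (hc : 0 ≤ c) {A : Op d} (hA : A.PosSemidef) :
    sqrtOp ((c : ℂ) • A) = ((Real.sqrt c : ℝ) : ℂ) • sqrtOp A := by
  refine sqrtOp_eq_of_mul_self ((posSemidef_sqrtOp hA).smul
    (by exact_mod_cast Real.sqrt_nonneg c)) ?_
  rw [smul_mul_smul_comm, sqrtOp_mul_self hA, ← Complex.ofReal_mul, Real.mul_self_sqrt hc]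

end SquareRoot

/-! ### Continuity and measurability of the square root. -/

section Measurability

open scoped Matrix.Norms.L2Operator MatrixOrder in
theorem continuousOn_sqrtOp : ContinuousOn (sqrtOp : Op d → Op d) {A | A.PosSemidef} := by
  have h := CFC.continuousOn_sqrt (A := Op d)
  have h0 : ∀ A : Op d, A.PosSemidef ↔ 0 ≤ A := fun A => Matrix.nonneg_iff_posSemidef.symm
  simp only [h0]
  refine h.congr fun A hA => ?_
  have hA' : A.PosSemidef := (h0 A).2 hA
  exact (CFC.sqrt_unique (sqrtOp_mul_self hA') ((h0 _).1 (posSemidef_sqrtOp hA'))).symm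

/-- Regarding matrices as points of a product space turns entrywise measurability into
measurability. The restriction to the subtype `S` matters because the square root is controlled only
on the positive cone. -/
theorem measurable_comp_of_continuousOn {X : Type*} [MeasurableSpace X] {F : X → Op d}
    {S : Set (Op d)} {g : Op d → ℂ} (hg : ContinuousOn g S) (hF : ∀ i j, Measurable fun x => F x i j)
    (hS : ∀ x, F x ∈ S) : Measurable fun x => g (F x) := by
  let G : X → Fin d → Fin d → ℂ := F
  let S' : Set (Fin d → Fin d → ℂ) := S
  let g' : (Fin d → Fin d → ℂ) → ℂ := g
  have hm : Measurable G := measurable_pi_iff.2 fun i => measurable_pi_iff.2 fun j => hF i j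
  have hg' : Continuous (S'.domRestrict g') := continuousOn_iff_continuous_domRestrict.1 hg
  exact hg'.measurable.comp (hm.subtype_mk (h := hS))

theorem measurable_sqrtOp {X : Type*} [MeasurableSpace X] {F : X → Op d}
    (hF : ∀ i j, Measurable fun x => F x i j) (hp : ∀ x, (F x).PosSemidef) (i j : Fin d) :
    Measurable fun x => sqrtOp (F x) i j :=
  measurable_comp_of_continuousOn (g := fun A => sqrtOp A i j)
    ((Continuous.matrix_elem continuous_id i j).comp_continuousOn continuousOn_sqrtOp) hF hp

end Measurability

/-! ### Linear maps that commute with unitary conjugation. -/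

section Commutant

/-- The unitary operator that permutes the standard basis. -/
def permUnitary (σ : Equiv.Perm (Fin d)) : UGroup d :=
  ⟨σ.permMatrix ℂ, by
    rw [Matrix.mem_unitaryGroup_iff, star_eq_conjTranspose, conjTranspose_permMatrix,
      ← permMatrix_mul]
    simp⟩

theorem permUnitary_conj (σ : Equiv.Perm (Fin d)) (A : Op d) :
    (permUnitary σ : Op d) * A * (permUnitary σ : Op d)ᴴ = A.submatrix σ σ := by
  change σ.permMatrix ℂ * A * (σ.permMatrix ℂ)ᴴ = _
  rw [conjTranspose_permMatrix, Equiv.Perm.permMatrix, PEquiv.toMatrix_toPEquiv_mul,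
    Equiv.Perm.permMatrix, PEquiv.mul_toMatrix_toPEquiv]
  rfl

/-- The reflection that flips the sign of the `k`-th coordinate. -/
def signUnitary (k : Fin d) : UGroup d :=
  ⟨diagonal fun j => if j = k then -1 else 1, by
    rw [Matrix.mem_unitaryGroup_iff, star_eq_conjTranspose, diagonal_conjTranspose,
      diagonal_mul_diagonal, ← diagonal_one]
    congr 1
    ext j
    by_cases h : j = k <;> simp [h]⟩

theorem signUnitary_conj_apply (k : Fin d) (A : Op d) (i j : Fin d) :
    ((signUnitary k : Op d) * A * (signUnitary k : Op d)ᴴ) i j =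
      (if i = k then -1 else 1) * A i j * (if j = k then -1 else 1) := by
  change ((diagonal fun j => if j = k then -1 else 1) * A *
    (diagonal fun j => if j = k then -1 else 1)ᴴ : Op d) i j = _
  rw [diagonal_conjTranspose, mul_diagonal, diagonal_mul]
  congr 1
  by_cases h : j = k <;> simp [h]

/-- Finitely many elements of the stabilizer suffice: sign flips kill the off-diagonal entries, and
transpositions fixing `i₀` equate the remaining diagonal ones. -/
theorem exists_eq_of_commutes_stabilizer {T : Op d} {i₀ : Fin d}
    (hT : ∀ W : UGroup d, (W : Op d) * single i₀ i₀ 1 * (W : Op d)ᴴ = single i₀ i₀ 1 →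
      (W : Op d) * T * (W : Op d)ᴴ = T) :
    ∃ a b : ℂ, T = a • single i₀ i₀ 1 + b • 1 := by
  have hoff : ∀ k l, k ≠ l → T k l = 0 := by
    intro k l hkl
    have h := congrFun₂ (hT (signUnitary k) (by
      ext i j
      rw [signUnitary_conj_apply]
      by_cases hij : i₀ = i ∧ i₀ = j
      · obtain ⟨rfl, rfl⟩ := hij
        split_ifs <;> simp
      · simp [hij])) k l
    rw [signUnitary_conj_apply] at h
    simp only [if_true, if_neg hkl.symm] at h
    linear_combination (-1 / 2 : ℂ) * h
  have hdiag : ∀ k l, k ≠ i₀ → l ≠ i₀ → T k k = T l l := by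
    intro k l hk hl
    have h := congrFun₂ (hT (permUnitary (Equiv.swap k l)) (by
      rw [permUnitary_conj]
      ext i j
      have hs : ∀ m, i₀ = Equiv.swap k l m ↔ i₀ = m := fun m => by
        rw [← Equiv.swap_apply_of_ne_of_ne hk.symm hl.symm, (Equiv.swap k l).apply_eq_iff_eq,
          Equiv.swap_apply_of_ne_of_ne hk.symm hl.symm]
      simp only [submatrix_apply, single_apply, hs])) l l
    rw [permUnitary_conj] at h
    simpa using h
  by_cases hex : ∃ k, k ≠ i₀
  · obtain ⟨k, hk⟩ := hex
    refine ⟨T i₀ i₀ - T k k, T k k, ?_⟩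
    ext i j
    by_cases hij : i = j
    · subst hij
      by_cases hi : i = i₀
      · subst hi; simp
      · simp [hdiag i k hi hk, Ne.symm hi]
    · have : ¬ (i₀ = i ∧ i₀ = j) := fun h => hij (h.1.symm.trans h.2)
      simp [hoff i j hij, one_apply_ne hij, this]
  · push Not at hex
    refine ⟨T i₀ i₀, 0, ?_⟩
    ext i j
    rw [hex i, hex j]
    simp

theorem exists_diagonalization_of_isHermitian {A : Op d} (hA : A.IsHermitian) :
    ∃ (V : UGroup d) (l : Fin d → ℂ),
      A = (V : Op d) * diagonal l * (V : Op d)ᴴ := by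
  refine ⟨hA.eigenvectorUnitary, fun i => hA.eigenvalues i, ?_⟩
  have := hA.spectral_theorem
  simpa [Unitary.conjStarAlgAut_apply, Function.comp_def, star_eq_conjTranspose] using this

/-- The unitary orbit of one rank-one projection spans all operators: the spectral theorem gives the
Hermitian ones, and real and imaginary parts the rest. -/
theorem linearMap_eq_zero_of_conj_single {B : Op d →ₗ[ℂ] Op d} {i₀ : Fin d}
    (hB : ∀ W : UGroup d, B ((W : Op d) * single i₀ i₀ 1 * (W : Op d)ᴴ) = 0) : B = 0 := by
  have hH : ∀ A : Op d, A.IsHermitian → B A = 0 := by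
    intro A hA
    obtain ⟨V, l, rfl⟩ := exists_diagonalization_of_isHermitian hA
    have hsum : (V : Op d) * diagonal l * (V : Op d)ᴴ =
        ∑ i, l i • (((V * permUnitary (Equiv.swap i₀ i) : UGroup d) : Op d) * single i₀ i₀ 1 *
          ((V * permUnitary (Equiv.swap i₀ i) : UGroup d) : Op d)ᴴ) := by
      have h1 : diagonal l = ∑ i, l i • ((permUnitary (Equiv.swap i₀ i) : Op d) *
          single i₀ i₀ 1 * (permUnitary (Equiv.swap i₀ i) : Op d)ᴴ) := by
        have h2 : ∀ i, (single i₀ i₀ (1 : ℂ)).submatrix (Equiv.swap i₀ i) (Equiv.swap i₀ i) =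
            single i i 1 := by
          intro i
          ext k m
          have hs : ∀ m, i₀ = Equiv.swap i₀ i m ↔ i = m := fun m => by
            rw [eq_comm, Equiv.swap_apply_eq_iff, Equiv.swap_apply_left, eq_comm]
          simp only [submatrix_apply, single_apply, hs]
        simp only [permUnitary_conj, h2]
        rw [← sum_single_eq_diagonal]
        refine Finset.sum_congr rfl fun i _ => ?_
        rw [smul_single, smul_eq_mul, mul_one]
      rw [h1, Finset.mul_sum, Finset.sum_mul]
      refine Finset.sum_congr rfl fun i _ => ?_
      rw [Matrix.mul_smul, Matrix.smul_mul, Submonoid.coe_mul, conjTranspose_mul]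
      simp only [Matrix.mul_assoc]
    rw [hsum, map_sum]
    refine Finset.sum_eq_zero fun i _ => ?_
    rw [map_smul, hB, smul_zero]
  ext1 A
  have hA := realPart_add_I_smul_imaginaryPart A
  rw [← hA, map_add, map_smul, hH _ (realPart A).2, hH _ (imaginaryPart A).2]
  simp

/-- By covariance the image of a rank-one projection is fixed by the stabilizer of that projection,
which fixes `a` and `b`. The difference of the two sides is again covariant, so it vanishes on the
whole orbit. -/
theorem exists_eq_of_covariant [NeZero d] (𝒜 : Op d →ₗ[ℂ] Op d)
    (h : ∀ (W : UGroup d) (ρ : Op d),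
      𝒜 ((W : Op d) * ρ * (W : Op d)ᴴ) = (W : Op d) * 𝒜 ρ * (W : Op d)ᴴ) :
    ∃ a b : ℂ, ∀ ρ, 𝒜 ρ = a • ρ + (b * ρ.trace) • (1 : Op d) := by
  obtain ⟨a, b, hab⟩ := exists_eq_of_commutes_stabilizer (T := 𝒜 (single 0 0 1)) (i₀ := 0)
    (fun W hW => by rw [← h, hW])
  refine ⟨a, b, fun ρ => ?_⟩
  let B : Op d →ₗ[ℂ] Op d :=
    𝒜 - a • LinearMap.id - ((b • traceLinearMap (Fin d) ℂ ℂ).smulRight (1 : Op d))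
  have hB : B = 0 := linearMap_eq_zero_of_conj_single (i₀ := 0) fun W => by
    simp only [B, LinearMap.sub_apply, h, hab, LinearMap.smul_apply, LinearMap.id_apply,
      LinearMap.smulRight_apply, traceLinearMap_apply, trace_conj, trace_single_eq_same]
    rw [Matrix.mul_add, Matrix.add_mul, Matrix.mul_smul, Matrix.smul_mul, Matrix.mul_smul,
      Matrix.smul_mul, Matrix.mul_one, coe_mul_conjTranspose]
    simp
  have := LinearMap.congr_fun hB ρ
  simp only [B, LinearMap.sub_apply, LinearMap.smul_apply, LinearMap.id_apply,
      LinearMap.smulRight_apply, traceLinearMap_apply, LinearMap.zero_apply, smul_eq_mul] at this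
  rw [← sub_eq_zero, ← this]
  abel

end Commutant

/-! ### Haar measure and the uniform ensemble. -/

section Haar

instance isProbabilityMeasure_haarU (d : ℕ) : IsProbabilityMeasure (haarU d) :=
  ⟨by simpa [haarU] using
    Measure.haarMeasure_self (K₀ := (⊤ : TopologicalSpace.PositiveCompacts (UGroup d)))⟩

instance isMulLeftInvariant_haarU (d : ℕ) : (haarU d).IsMulLeftInvariant :=
  Measure.isMulLeftInvariant_haarMeasure _

theorem continuous_mulVec_single [NeZero d] :
    Continuous fun U : UGroup d => (U : Op d) *ᵥ (Pi.single 0 1 : Fin d → ℂ) :=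
  Continuous.matrix_mulVec continuous_subtype_val continuous_const

theorem measurable_unitary_apply (i j : Fin d) : Measurable fun U : UGroup d => (U : Op d) i j :=
  (Continuous.matrix_elem continuous_subtype_val i j).measurable

instance isProbabilityMeasure_uniformEnsemble [NeZero d] :
    IsProbabilityMeasure (uniformEnsemble d) :=
  Measure.isProbabilityMeasure_map continuous_mulVec_single.measurable.aemeasurable

theorem ae_unit [NeZero d] : ∀ᵐ ψ ∂(uniformEnsemble d), star ψ ⬝ᵥ ψ = 1 := by
  rw [uniformEnsemble, ae_map_iff continuous_mulVec_single.measurable.aemeasurable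
    (isClosed_eq (by fun_prop) continuous_const).measurableSet]
  refine Filter.Eventually.of_forall fun U => ?_
  rw [star_mulVec, ← dotProduct_mulVec, mulVec_mulVec, conjTranspose_mul_coe, one_mulVec]
  simp

theorem map_mulVec_uniformEnsemble [NeZero d] (W : UGroup d) :
    (uniformEnsemble d).map (fun ψ => (W : Op d) *ᵥ ψ) = uniformEnsemble d := by
  have hW : Measurable fun ψ : Fin d → ℂ => (W : Op d) *ᵥ ψ :=
    (Continuous.matrix_mulVec continuous_const continuous_id).measurable
  conv_rhs => rw [uniformEnsemble, ← map_mul_left_eq_self (haarU d) W]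
  rw [uniformEnsemble, Measure.map_map hW continuous_mulVec_single.measurable,
    Measure.map_map continuous_mulVec_single.measurable (measurable_const_mul W)]
  congr 1
  ext U : 1
  simp only [Function.comp_apply, mulVec_mulVec, Submonoid.coe_mul]

theorem integral_mulVec_uniformEnsemble [NeZero d] {E : Type*} [NormedAddCommGroup E]
    [NormedSpace ℝ E] (W : UGroup d) (f : (Fin d → ℂ) → E) :
    ∫ ψ, f ((W : Op d) *ᵥ ψ) ∂(uniformEnsemble d) = ∫ ψ, f ψ ∂(uniformEnsemble d) := by
  have hc : ∀ W : UGroup d, Continuous fun ψ : Fin d → ℂ => (W : Op d) *ᵥ ψ := fun W =>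
    Continuous.matrix_mulVec continuous_const continuous_id
  let e : (Fin d → ℂ) ≃ₜ (Fin d → ℂ) :=
    { toFun := fun ψ => (W : Op d) *ᵥ ψ
      invFun := fun ψ => ((W⁻¹ : UGroup d) : Op d) *ᵥ ψ
      left_inv := fun ψ => by
        simp only [mulVec_mulVec, ← Submonoid.coe_mul, inv_mul_cancel, OneMemClass.coe_one,
          one_mulVec]
      right_inv := fun ψ => by
        simp only [mulVec_mulVec, ← Submonoid.coe_mul, mul_inv_cancel, OneMemClass.coe_one,
          one_mulVec]
      continuous_toFun := hc W
      continuous_invFun := hc W⁻¹ }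
  -- A homeomorphism is a measurable embedding, so the change of variables needs no measurability of
  -- `f`.
  have he : MeasurableEmbedding fun ψ : Fin d → ℂ => (W : Op d) *ᵥ ψ := e.measurableEmbedding
  conv_rhs => rw [← map_mulVec_uniformEnsemble W, he.integral_map]

theorem integrable_uniformEnsemble_of_continuous [NeZero d] {E : Type*} [NormedAddCommGroup E]
    [SecondCountableTopology E] {f : (Fin d → ℂ) → E} (hf : Continuous f) :
    Integrable f (uniformEnsemble d) := by
  borelize E
  rw [uniformEnsemble, integrable_map_measure hf.stronglyMeasurable.aestronglyMeasurable
    continuous_mulVec_single.measurable.aemeasurable]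
  exact (hf.comp continuous_mulVec_single).integrable_of_hasCompactSupport
    (HasCompactSupport.of_compactSpace _)

end Haar

/-! ### Entrywise integrals of operators. -/

section OpIntegral

variable {X : Type*} [MeasurableSpace X] {ν : Measure X}

theorem opIntegral_mul_mul {G : X → Op d} (hG : ∀ i j, Integrable (fun x => G x i j) ν)
    (A B : Op d) : opIntegral ν (fun x => A * G x * B) = A * opIntegral ν G * B := by
  ext i j
  simp only [opIntegral, of_apply, mul_apply, Finset.sum_mul]
  rw [integral_finsetSum _ fun k _ => integrable_finsetSum _ fun l _ =>
    ((hG l k).const_mul _).mul_const _]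
  refine Finset.sum_congr rfl fun k _ => ?_
  rw [integral_finsetSum _ fun l _ => ((hG l k).const_mul _).mul_const _]
  refine Finset.sum_congr rfl fun l _ => ?_
  rw [integral_mul_const, integral_const_mul]

theorem trace_opIntegral {G : X → Op d} (hG : ∀ i j, Integrable (fun x => G x i j) ν) :
    (opIntegral ν G).trace = ∫ x, (G x).trace ∂ν := by
  simp only [trace, diag, opIntegral, of_apply]
  rw [integral_finsetSum _ fun i _ => hG i i]

theorem opIntegral_add {G H : X → Op d} (hG : ∀ i j, Integrable (fun x => G x i j) ν)
    (hH : ∀ i j, Integrable (fun x => H x i j) ν) :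
    opIntegral ν (fun x => G x + H x) = opIntegral ν G + opIntegral ν H := by
  ext i j
  exact integral_add (hG i j) (hH i j)

theorem opIntegral_smul (c : ℂ) (G : X → Op d) :
    opIntegral ν (fun x => c • G x) = c • opIntegral ν G := by
  ext i j
  exact integral_const_mul c _

end OpIntegral

/-! ### First and second moments of the uniform ensemble. -/

section Moments

theorem ketbra_mulVec (W : Op d) (ψ : Fin d → ℂ) : ketbra (W *ᵥ ψ) = W * ketbra ψ * Wᴴ := by
  rw [ketbra, ketbra, star_mulVec, mul_vecMulVec, vecMulVec_mul]

theorem continuous_ketbra : Continuous (ketbra : (Fin d → ℂ) → Op d) :=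
  Continuous.matrix_vecMulVec continuous_id (by fun_prop)

theorem trace_mul_ketbra (A : Op d) (ψ : Fin d → ℂ) :
    (A * ketbra ψ).trace = star ψ ⬝ᵥ A *ᵥ ψ := by
  rw [ketbra, mul_vecMulVec, trace_vecMulVec, dotProduct_comm]

theorem trace_conj_mul_ketbra (W : UGroup d) (A : Op d) (ψ : Fin d → ℂ) :
    ((W : Op d) * A * (W : Op d)ᴴ * ketbra ((W : Op d) *ᵥ ψ)).trace = (A * ketbra ψ).trace := by
  rw [ketbra_mulVec, conj_mul_conj, trace_conj]

theorem continuous_trace_mul_ketbra (A : Op d) : Continuous fun ψ => (A * ketbra ψ).trace :=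
  Continuous.matrix_trace (continuous_const.matrix_mul continuous_ketbra)

/-- The second moment map `A ↦ ∫ ⟨ψ|A|ψ⟩ |ψ⟩⟨ψ| dΩ(ψ)`. -/
noncomputable def momentMap [NeZero d] (A : Op d) : Op d :=
  opIntegral (uniformEnsemble d) fun ψ => (A * ketbra ψ).trace • ketbra ψ

theorem integrable_trace_smul_ketbra [NeZero d] (A : Op d) (i j : Fin d) :
    Integrable (fun ψ => ((A * ketbra ψ).trace • ketbra ψ) i j) (uniformEnsemble d) :=
  integrable_uniformEnsemble_of_continuous
    (((continuous_trace_mul_ketbra A).smul continuous_ketbra).matrix_elem i j)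

theorem integrable_ketbra [NeZero d] (i j : Fin d) :
    Integrable (fun ψ => (ketbra ψ) i j) (uniformEnsemble d) :=
  integrable_uniformEnsemble_of_continuous (continuous_ketbra.matrix_elem i j)

theorem momentMap_conj [NeZero d] (W : UGroup d) (A : Op d) :
    momentMap ((W : Op d) * A * (W : Op d)ᴴ) = (W : Op d) * momentMap A * (W : Op d)ᴴ := by
  rw [momentMap, momentMap, ← opIntegral_mul_mul (integrable_trace_smul_ketbra A)]
  ext i j
  simp only [opIntegral, of_apply]
  rw [← integral_mulVec_uniformEnsemble W]
  simp only [trace_conj_mul_ketbra]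
  simp only [ketbra_mulVec, Matrix.mul_smul, Matrix.smul_mul]

theorem momentMap_one [NeZero d] :
    momentMap (1 : Op d) = opIntegral (uniformEnsemble d) ketbra := by
  ext i j
  refine integral_congr_ae ?_
  filter_upwards [ae_unit] with ψ hψ
  rw [trace_mul_ketbra, one_mulVec, hψ, one_smul]

/-- Both sides are `∫ |ψ i|² |ψ j|²`. This exchange symmetry forces the two constants of the
covariant form to agree. -/
theorem momentMap_single [NeZero d] (i j : Fin d) :
    momentMap (single i j (1 : ℂ)) i j = momentMap (single j j (1 : ℂ)) i i := by
  simp only [momentMap, opIntegral, of_apply]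
  refine integral_congr_ae (Filter.Eventually.of_forall fun ψ => ?_)
  simp only [Matrix.smul_apply, smul_eq_mul, trace_single_mul, ketbra, vecMulVec_apply,
    Pi.star_apply, one_mul]
  ring

theorem momentMap_eq [NeZero d] (A : Op d) :
    momentMap A = ((d * (d + 1) : ℂ)⁻¹) • (A + A.trace • (1 : Op d)) := by
  let M : Op d →ₗ[ℂ] Op d :=
    { toFun := momentMap
      map_add' := fun A B => by
        rw [momentMap, momentMap, momentMap, ← opIntegral_add (integrable_trace_smul_ketbra A)
          (integrable_trace_smul_ketbra B)]
        simp only [Matrix.add_mul, trace_add, add_smul]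
      map_smul' := fun c A => by
        rw [momentMap, momentMap, RingHom.id_apply, ← opIntegral_smul]
        simp only [Matrix.smul_mul, trace_smul, smul_smul, smul_eq_mul] }
  obtain ⟨a, b, hab⟩ := exists_eq_of_covariant M momentMap_conj
  replace hab : ∀ A, momentMap A = a • A + (b * A.trace) • (1 : Op d) := hab
  have hd : (d : ℂ) ≠ 0 := Nat.cast_ne_zero.2 (NeZero.ne d)
  have hd1 : (d : ℂ) + 1 ≠ 0 := Nat.cast_add_one_ne_zero d
  have h1 : (momentMap (1 : Op d)).trace = 1 := by
    rw [momentMap_one, trace_opIntegral integrable_ketbra]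
    have h : (fun ψ => (ketbra ψ).trace) =ᵐ[uniformEnsemble d] fun _ => (1 : ℂ) := by
      filter_upwards [ae_unit] with ψ hψ
      rw [ketbra, trace_vecMulVec, dotProduct_comm, hψ]
    rw [integral_congr_ae h]
    simp
  rw [hab] at h1
  simp only [trace_add, trace_smul, trace_one, Fintype.card_fin, smul_eq_mul] at h1
  -- For `d ≥ 2`, distinct indices in `momentMap_single` give `a = b`. For `d = 1` the operators `A`
  -- and `tr A • 1` coincide, and only `a + b = 1` is determined or needed.
  rcases Nat.lt_or_ge 1 d with hd2 | hd2
  · have h := momentMap_single (⟨0, by omega⟩ : Fin d) ⟨1, hd2⟩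
    rw [hab, hab] at h
    have hab' : a = b := by simpa [trace_single_eq_of_ne] using h
    subst hab'
    have ha : a = (d * (d + 1) : ℂ)⁻¹ := by
      refine eq_inv_of_mul_eq_one_left ?_
      linear_combination h1
    rw [hab, ha, smul_add, smul_smul]
  · obtain rfl : d = 1 := le_antisymm hd2 (NeZero.one_le)
    rw [hab]
    have hA : A = A.trace • 1 := by
      ext i j
      rw [Subsingleton.elim i 0, Subsingleton.elim j 0]
      simp [trace]
    have hab' : a + b = 1 := by simpa using h1
    rw [hA]
    simp only [trace_smul, trace_one, smul_smul, ← add_smul]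
    congr 1
    simp only [Fintype.card_fin, Nat.cast_one, smul_eq_mul]
    linear_combination A.trace * hab'

theorem opIntegral_ketbra [NeZero d] :
    opIntegral (uniformEnsemble d) ketbra = ((d : ℂ)⁻¹) • (1 : Op d) := by
  have hd : (d : ℂ) ≠ 0 := Nat.cast_ne_zero.2 (NeZero.ne d)
  have hd1 : (d : ℂ) + 1 ≠ 0 := Nat.cast_add_one_ne_zero d
  rw [← momentMap_one, momentMap_eq, trace_one, Fintype.card_fin]
  have : (1 : Op d) + (d : ℂ) • 1 = ((d : ℂ) + 1) • 1 := by rw [add_smul, one_smul, add_comm]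
  rw [this, smul_smul]
  congr 1
  field_simp

theorem integrable_trace_mul_ketbra [NeZero d] (A : Op d) :
    Integrable (fun ψ => (A * ketbra ψ).trace) (uniformEnsemble d) :=
  integrable_uniformEnsemble_of_continuous (continuous_trace_mul_ketbra A)

theorem integral_trace_mul_ketbra [NeZero d] (A : Op d) :
    ∫ ψ, (A * ketbra ψ).trace ∂(uniformEnsemble d) = A.trace / d := by
  have hint : ∀ i j, Integrable (fun ψ => (A * ketbra ψ) i j) (uniformEnsemble d) := fun i j =>
    integrable_uniformEnsemble_of_continuous
      ((continuous_const.matrix_mul continuous_ketbra).matrix_elem i j)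
  rw [← trace_opIntegral hint]
  have := opIntegral_mul_mul (ν := uniformEnsemble d) integrable_ketbra A 1
  simp only [Matrix.mul_one] at this
  rw [this, opIntegral_ketbra, Matrix.mul_smul, Matrix.mul_one, trace_smul, smul_eq_mul]
  ring

theorem integral_trace_mul_trace [NeZero d] (A B : Op d) :
    ∫ ψ, (A * ketbra ψ).trace * (B * ketbra ψ).trace ∂(uniformEnsemble d) =
      ((A * B).trace + A.trace * B.trace) / (d * (d + 1)) := by
  have hint : ∀ i j, Integrable (fun ψ => (B * ((A * ketbra ψ).trace • ketbra ψ)) i j)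
      (uniformEnsemble d) := fun i j => integrable_uniformEnsemble_of_continuous
      ((continuous_const.matrix_mul
        ((continuous_trace_mul_ketbra A).smul continuous_ketbra)).matrix_elem i j)
  have h1 := opIntegral_mul_mul (integrable_trace_smul_ketbra A) B 1
  simp only [Matrix.mul_one] at h1
  have h2 := trace_opIntegral hint
  rw [h1] at h2
  simp only [Matrix.mul_smul, trace_smul, smul_eq_mul] at h2
  rw [← h2, ← momentMap, momentMap_eq, Matrix.mul_smul, trace_smul, Matrix.mul_add, trace_add,
    Matrix.mul_smul, Matrix.mul_one, trace_smul, trace_mul_comm B A, smul_eq_mul, smul_eq_mul]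
  ring

end Moments

/-! ### Fidelity to a pure state. -/

section Fidelity

theorem condProb_nonneg {A : Op d} (hA : A.PosSemidef) (ψ : Fin d → ℂ) : 0 ≤ condProb A ψ := by
  rw [condProb, trace_mul_ketbra]
  exact (Complex.le_def.1 (hA.dotProduct_mulVec_nonneg ψ)).1

theorem ofReal_condProb {A : Op d} (hA : A.PosSemidef) (ψ : Fin d → ℂ) :
    (condProb A ψ : ℂ) = (A * ketbra ψ).trace := by
  have h := hA.dotProduct_mulVec_nonneg ψ
  rw [← trace_mul_ketbra] at h
  exact Complex.ext (by simp [condProb]) (by simpa using (Complex.nonneg_iff.1 h).2)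

theorem ketbra_mul_mul_ketbra (ψ : Fin d → ℂ) (B : Op d) :
    ketbra ψ * B * ketbra ψ = (B * ketbra ψ).trace • ketbra ψ := by
  rw [trace_mul_ketbra]
  simp only [ketbra]
  rw [Matrix.mul_assoc, mul_vecMulVec, vecMulVec_mul_vecMulVec, vecMulVec_smul]

theorem ketbra_mul_self {ψ : Fin d → ℂ} (hψ : star ψ ⬝ᵥ ψ = 1) :
    ketbra ψ * ketbra ψ = ketbra ψ := by
  have := ketbra_mul_mul_ketbra ψ 1
  rwa [Matrix.mul_one, trace_mul_ketbra, one_mulVec, hψ, one_smul] at this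

theorem posSemidef_ketbra (ψ : Fin d → ℂ) : (ketbra ψ).PosSemidef :=
  posSemidef_vecMulVec_self_star ψ

/-- Compressing `A` to the orthogonal complement of `ψ` leaves a positive operator, whose trace is
the difference of the two sides. -/
theorem condProb_le_trace {A : Op d} (hA : A.PosSemidef) {ψ : Fin d → ℂ}
    (hψ : star ψ ⬝ᵥ ψ = 1) : condProb A ψ ≤ A.trace.re := by
  have hK : (1 - ketbra ψ)ᴴ = 1 - ketbra ψ := by
    rw [conjTranspose_sub, conjTranspose_one, (posSemidef_ketbra ψ).isHermitian.eq]
  have h2 : (1 - ketbra ψ) * (1 - ketbra ψ) = 1 - ketbra ψ := by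
    rw [Matrix.mul_sub, Matrix.sub_mul, Matrix.sub_mul, ketbra_mul_self hψ]
    simp
  have h := (hA.conjTranspose_mul_mul_same (1 - ketbra ψ)).trace_nonneg
  rw [hK, trace_mul_comm, ← Matrix.mul_assoc, h2, trace_mul_comm, Matrix.mul_sub, Matrix.mul_one,
    trace_sub] at h
  have := (Complex.le_def.1 h).1
  simp only [Complex.zero_re, Complex.sub_re] at this
  rw [condProb]
  linarith

/-- The projection is its own square root, and sandwiching `σ` by it gives the multiple `⟨ψ|σ|ψ⟩` of
the projection. The root and the outer square then cancel. -/
theorem fidelity_ketbra {ψ : Fin d → ℂ} (hψ : star ψ ⬝ᵥ ψ = 1) {σ : Op d} (hσ : σ.PosSemidef) :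
    fidelity (ketbra ψ) σ = condProb σ ψ := by
  rw [fidelity, sqrtOp_eq_of_mul_self (posSemidef_ketbra ψ) (ketbra_mul_self hψ),
    ketbra_mul_mul_ketbra, ← ofReal_condProb hσ,
    sqrtOp_smul (condProb_nonneg hσ ψ) (posSemidef_ketbra ψ),
    sqrtOp_eq_of_mul_self (posSemidef_ketbra ψ) (ketbra_mul_self hψ), trace_smul, ketbra,
    trace_vecMulVec, dotProduct_comm, hψ]
  simp [Real.sq_sqrt (condProb_nonneg hσ ψ)]

end Fidelity

/-! ### Average fidelity of an operation, and its maximum for a given effect. -/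

section Kraus

variable {ι : Type*} [Fintype ι] {A : ι → Op d} {𝒜 : Op d → Op d}

theorem IsKrausDecomposition.posSemidef (h : IsKrausDecomposition A 𝒜) {ρ : Op d}
    (hρ : ρ.PosSemidef) : (𝒜 ρ).PosSemidef := by
  rw [h]
  exact posSemidef_sum _ fun i _ => hρ.mul_mul_conjTranspose_same _

theorem IsKrausDecomposition.trace_apply (h : IsKrausDecomposition A 𝒜) (ρ : Op d) :
    (𝒜 ρ).trace = ((∑ i, (A i)ᴴ * A i) * ρ).trace := by
  rw [h, Finset.sum_mul, trace_sum, trace_sum]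
  exact Finset.sum_congr rfl fun i _ => by rw [Matrix.trace_mul_cycle]

theorem IsKrausDecomposition.condProb_apply (h : IsKrausDecomposition A 𝒜) (ψ : Fin d → ℂ) :
    (condProb (𝒜 (ketbra ψ)) ψ : ℂ) =
      ∑ i, (A i * ketbra ψ).trace * ((A i)ᴴ * ketbra ψ).trace := by
  rw [ofReal_condProb (h.posSemidef (posSemidef_ketbra ψ)), h, Finset.sum_mul, trace_sum]
  refine Finset.sum_congr rfl fun i _ => ?_
  rw [Matrix.mul_assoc, Matrix.mul_assoc, ← Matrix.mul_assoc (ketbra ψ), ketbra_mul_mul_ketbra,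
    Matrix.mul_smul, trace_smul, smul_eq_mul, mul_comm]

/-- Each Kraus operator contributes `⟨ψ|A|ψ⟩⟨ψ|A†|ψ⟩`, to which the second moment formula applies.
-/
theorem IsKrausDecomposition.integral_fidelity [NeZero d] (h : IsKrausDecomposition A 𝒜) :
    ∫ ψ, condProb (𝒜 (ketbra ψ)) ψ ∂(uniformEnsemble d) =
      ((∑ i, (A i)ᴴ * A i).trace.re + ∑ i, Complex.normSq (A i).trace) / (d * (d + 1)) := by
  apply Complex.ofReal_injective
  rw [← integral_complex_ofReal]
  simp only [h.condProb_apply]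
  have hint : ∀ i, Integrable (fun ψ => (A i * ketbra ψ).trace * ((A i)ᴴ * ketbra ψ).trace)
      (uniformEnsemble d) := fun i => integrable_uniformEnsemble_of_continuous
    ((continuous_trace_mul_ketbra (A i)).mul (continuous_trace_mul_ketbra (A i)ᴴ))
  rw [integral_finsetSum _ fun i _ => hint i]
  simp only [integral_trace_mul_trace]
  have hE : ((∑ i, (A i)ᴴ * A i).trace.re : ℂ) = ∑ i, (A i * (A i)ᴴ).trace := by
    have hp : (∑ i, (A i)ᴴ * A i).PosSemidef :=
      posSemidef_sum _ fun i _ => posSemidef_conjTranspose_mul_self _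
    have : ((∑ i, (A i)ᴴ * A i).trace.re : ℂ) = (∑ i, (A i)ᴴ * A i).trace :=
      Complex.ext (by simp) (by simpa using (Complex.nonneg_iff.1 hp.trace_nonneg).2)
    rw [this, trace_sum]
    exact Finset.sum_congr rfl fun i _ => trace_mul_comm _ _
  push_cast
  rw [hE, ← Finset.sum_div, Finset.sum_add_distrib]
  congr 2
  refine Finset.sum_congr rfl fun i _ => ?_
  rw [trace_conjTranspose, Complex.normSq_eq_conj_mul_self, mul_comm]
  rfl

/-- Minkowski's inequality for the traces of Kraus operators. -/
theorem sum_normSq_trace_le (A : ι → Op d) :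
    ∑ i, Complex.normSq (A i).trace ≤ (sqrtOp (∑ i, (A i)ᴴ * A i)).trace.re ^ 2 := by
  have hp : (∑ i, (A i)ᴴ * A i).PosSemidef :=
    posSemidef_sum _ fun i _ => posSemidef_conjTranspose_mul_self _
  obtain ⟨V, l, hl, hV⟩ := exists_diagonalization hp
  have htr : (sqrtOp (∑ i, (A i)ᴴ * A i)).trace.re = ∑ j, Real.sqrt (l j) := by
    rw [hV, sqrtOp_conj V (posSemidef_diagonal_ofReal hl), trace_conj, sqrtOp_diagonal hl,
      trace_diagonal, ← Complex.ofReal_sum, Complex.ofReal_re]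
  let B : ι → Op d := fun i => (V : Op d)ᴴ * A i * (V : Op d)
  have hBtr : ∀ i, (B i).trace = (A i).trace := fun i => by
    rw [Matrix.trace_mul_cycle, coe_mul_conjTranspose, Matrix.one_mul]
  have hBsum : ∑ i, (B i)ᴴ * B i = diagonal fun j => (l j : ℂ) := by
    have h1 : ∀ i, (B i)ᴴ * B i = (V : Op d)ᴴ * ((A i)ᴴ * A i) * (V : Op d) := fun i => by
      simp only [B, conjTranspose_mul, conjTranspose_conjTranspose]
      calc _ = (V : Op d)ᴴ * (A i)ᴴ * ((V : Op d) * (V : Op d)ᴴ) * A i * (V : Op d) := by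
            simp only [Matrix.mul_assoc]
        _ = _ := by rw [coe_mul_conjTranspose]; simp only [Matrix.mul_assoc, Matrix.one_mul]
    simp only [h1]
    rw [← Finset.sum_mul, ← Finset.mul_sum, hV]
    calc _ = ((V : Op d)ᴴ * (V : Op d)) * (diagonal fun j => (l j : ℂ)) *
          ((V : Op d)ᴴ * (V : Op d)) := by simp only [Matrix.mul_assoc]
      _ = _ := by rw [conjTranspose_mul_coe, Matrix.one_mul, Matrix.mul_one]
  -- Collect the `j`-th diagonal entries of all Kraus operators, in an eigenbasis of the effect,
  -- into one vector. Its squared norm is at most the eigenvalue `l j`, while the squared norm of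
  -- the sum over `j` is `∑ |tr A i|²`; the triangle inequality finishes.
  let v : Fin d → EuclideanSpace ℂ ι := fun j => WithLp.toLp 2 fun i => B i j j
  have hv : ∀ j, ‖v j‖ ≤ Real.sqrt (l j) := by
    intro j
    rw [EuclideanSpace.norm_eq]
    refine Real.sqrt_le_sqrt ?_
    have h := congrArg Complex.re (congrFun₂ hBsum j j)
    rw [diagonal_apply_eq, Complex.ofReal_re, Matrix.sum_apply, Complex.re_sum] at h
    rw [← h]
    refine Finset.sum_le_sum fun i _ => ?_
    rw [mul_apply, Complex.re_sum]
    refine le_trans (le_of_eq ?_) (Finset.single_le_sum (f := fun k =>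
      ((B i)ᴴ j k * B i k j).re) (fun k _ => ?_) (Finset.mem_univ j))
    · simp [v, conjTranspose_apply, ← Complex.normSq_eq_norm_sq, Complex.normSq_apply]
    · simp only [conjTranspose_apply, Complex.star_def, Complex.mul_re, Complex.conj_re,
        Complex.conj_im]
      nlinarith [mul_self_nonneg (B i k j).re, mul_self_nonneg (B i k j).im]
  have hsum : ∑ i, Complex.normSq (A i).trace = ‖∑ j, v j‖ ^ 2 := by
    rw [EuclideanSpace.norm_sq_eq]
    refine Finset.sum_congr rfl fun i _ => ?_
    rw [← hBtr, Complex.normSq_eq_norm_sq]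
    simp [v, trace]
  rw [hsum, htr]
  gcongr
  exact (norm_sum_le _ _).trans (Finset.sum_le_sum fun j _ => hv j)

/-- The largest average fidelity to the input among the operations compatible with an effect. -/
noncomputable def optimalFidelity (E : Op d) : ℝ :=
  (E.trace.re + (sqrtOp E).trace.re ^ 2) / (d * (d + 1))

theorem integral_fidelity_le [NeZero d] {E : Op d} (h : IsCompatible E 𝒜) :
    ∫ ψ, condProb (𝒜 (ketbra ψ)) ψ ∂(uniformEnsemble d) ≤ optimalFidelity E := by
  obtain ⟨r, A, hA, rfl⟩ := h
  rw [hA.integral_fidelity, optimalFidelity]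
  gcongr
  exact sum_normSq_trace_le A

theorem integral_fidelity_sqrtOp [NeZero d] {E : Op d} (hE : E.PosSemidef) :
    ∫ ψ, condProb (sqrtOp E * ketbra ψ * sqrtOp E) ψ ∂(uniformEnsemble d) =
      optimalFidelity E := by
  have hS := posSemidef_sqrtOp hE
  have hK : IsKrausDecomposition (fun _ : Unit => sqrtOp E)
      (fun ρ => sqrtOp E * ρ * sqrtOp E) := fun ρ => by simp [hS.isHermitian.eq]
  have h := hK.integral_fidelity
  simp only [Finset.univ_unique, Finset.sum_singleton, hS.isHermitian.eq,
    sqrtOp_mul_self hE] at h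
  rw [h, optimalFidelity]
  congr 2
  rw [Complex.normSq_apply, (Complex.nonneg_iff.1 hS.trace_nonneg).2.symm]
  ring

theorem isCompatible_sqrtOp {E : Op d} (hE : E.PosSemidef) :
    IsCompatible E (fun ρ => sqrtOp E * ρ * sqrtOp E) := by
  have hS := posSemidef_sqrtOp hE
  exact ⟨1, fun _ => sqrtOp E, fun ρ => by simp [hS.isHermitian.eq], by
    simp [hS.isHermitian.eq, sqrtOp_mul_self hE]⟩

/-- Kraus form implies linearity. The expansion upgrades measurability in the outcome at fixed `ρ`
to joint measurability in outcome and input. -/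
theorem IsCompatible.apply_eq_sum {E : Op d} (h : IsCompatible E 𝒜) (ρ : Op d) :
    𝒜 ρ = ∑ i, ∑ j, ρ i j • 𝒜 (single i j 1) := by
  obtain ⟨r, A, hA, -⟩ := h
  let f : Op d →ₗ[ℂ] Op d :=
    { toFun := fun ρ => ∑ i, A i * ρ * (A i)ᴴ
      map_add' := fun ρ σ => by
        simp only [Matrix.mul_add, Matrix.add_mul, Finset.sum_add_distrib]
      map_smul' := fun c ρ => by
        simp only [Matrix.mul_smul, Matrix.smul_mul, Finset.smul_sum, RingHom.id_apply] }
  have hf : ∀ ρ, 𝒜 ρ = f ρ := hA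
  simp only [hf, ← map_smul, ← map_sum, smul_single, smul_eq_mul, mul_one]
  rw [← matrix_eq_sum_single]

end Kraus

/-! ### Joint measurability, and the total trace of a POVM. -/

section JointMeasurability

variable {X : Type*} [MeasurableSpace X] {ν : Measure X} {F : X → Op d}

theorem measurable_condProb {Z : Type*} [MeasurableSpace Z] {G : Z → Op d} {φ : Z → Fin d → ℂ}
    (hG : ∀ i j, Measurable fun z => G z i j) (hφ : Measurable φ) :
    Measurable fun z => condProb (G z) (φ z) := by
  have hφ' : ∀ i, Measurable fun z => φ z i := fun i => (measurable_pi_apply i).comp hφ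
  simp only [condProb, trace_mul_ketbra, dotProduct, mulVec, Pi.star_apply]
  refine Complex.measurable_re.comp (Finset.measurable_sum _ fun i _ => ?_)
  exact (continuous_star.measurable.comp (hφ' i)).mul
    (Finset.measurable_sum _ fun j _ => (hG i j).mul (hφ' j))

theorem measurable_ketbra_apply (i j : Fin d) : Measurable fun ψ => ketbra ψ i j :=
  (continuous_ketbra.matrix_elem i j).measurable

theorem measurable_trace_re (hF : ∀ i j, Measurable fun x => F x i j) :
    Measurable fun x => (F x).trace.re :=
  Complex.measurable_re.comp (Finset.measurable_sum _ fun i _ => hF i i)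

theorem IsPOVM.integrable_trace (h : IsPOVM ν F) : Integrable (fun x => (F x).trace.re) ν :=
  (integrable_finsetSum _ fun i _ => h.integrable i i).re

theorem IsPOVM.integral_trace (h : IsPOVM ν F) : ∫ x, (F x).trace.re ∂ν = d := by
  have h1 := trace_opIntegral h.integrable
  rw [h.integral_eq_one, trace_one, Fintype.card_fin] at h1
  have h2 : Integrable (fun x => (F x).trace) ν :=
    integrable_finsetSum _ fun i _ => h.integrable i i
  have h3 := integral_re h2
  rw [← h1] at h3
  simpa using h3

end JointMeasurability

/-! ### Information and optimal fidelity as integrals over effects. -/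

section Densities

variable {X : Type*} [MeasurableSpace X] {ν : Measure X} {F : X → Op d}

theorem condProb_conj_mulVec (W : UGroup d) (E : Op d) (ψ : Fin d → ℂ) :
    condProb ((W : Op d) * E * (W : Op d)ᴴ) ((W : Op d) *ᵥ ψ) = condProb E ψ := by
  rw [condProb, trace_conj_mul_ketbra, condProb]

theorem optimalFidelity_conj (W : UGroup d) {E : Op d} (hE : E.PosSemidef) :
    optimalFidelity ((W : Op d) * E * (W : Op d)ᴴ) = optimalFidelity E := by
  rw [optimalFidelity, sqrtOp_conj W hE, trace_conj, trace_conj, optimalFidelity]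

theorem condProb_smul (c : ℝ) (E : Op d) (ψ : Fin d → ℂ) :
    condProb ((c : ℂ) • E) ψ = c * condProb E ψ := by
  rw [condProb, Matrix.smul_mul, trace_smul, smul_eq_mul, Complex.re_ofReal_mul, condProb]

theorem optimalFidelity_smul {c : ℝ} (hc : 0 ≤ c) {E : Op d} (hE : E.PosSemidef) :
    optimalFidelity ((c : ℂ) • E) = c * optimalFidelity E := by
  rw [optimalFidelity, sqrtOp_smul hc hE, trace_smul, trace_smul, smul_eq_mul, smul_eq_mul,
    Complex.re_ofReal_mul, Complex.re_ofReal_mul, mul_pow, Real.sq_sqrt hc, optimalFidelity]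
  ring

theorem IsPOVM.isProcedure_sqrtDynamics (h : IsPOVM ν F) :
    IsProcedure ν F (sqrtDynamics F) where
  povm := h
  measurable ρ i j := by
    have hS := measurable_sqrtOp h.measurable h.posSemidef
    simp only [sqrtDynamics, mul_apply]
    exact Finset.measurable_sum _ fun k _ =>
      (Finset.measurable_sum _ fun l _ => (hS i l).mul_const _).mul (hS k j)
  compatible x := isCompatible_sqrtOp (h.posSemidef x)

variable [NeZero d]

theorem meanProb_eq (E : Op d) : meanProb E = E.trace.re / d := by
  have h := integral_re (integrable_trace_mul_ketbra E)
  rw [integral_trace_mul_ketbra] at h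
  simp only [meanProb, condProb]
  refine Eq.trans h ?_
  rw [← Complex.ofReal_natCast]
  exact Complex.div_ofReal_re _ _

theorem meanProb_nonneg {E : Op d} (hE : E.PosSemidef) : 0 ≤ meanProb E :=
  integral_nonneg fun ψ => condProb_nonneg hE ψ

/-- The information density `∫ p(x|ψ) log (p(x|ψ) / p(x)) dΩ(ψ)` of an effect. -/
noncomputable def infoDensity (E : Op d) : ℝ :=
  ∫ ψ, condProb E ψ * Real.log (condProb E ψ / meanProb E) ∂(uniformEnsemble d)

theorem meanProb_conj (W : UGroup d) (E : Op d) :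
    meanProb ((W : Op d) * E * (W : Op d)ᴴ) = meanProb E := by
  rw [meanProb_eq, trace_conj, meanProb_eq]

theorem infoDensity_conj (W : UGroup d) (E : Op d) :
    infoDensity ((W : Op d) * E * (W : Op d)ᴴ) = infoDensity E := by
  rw [infoDensity, ← integral_mulVec_uniformEnsemble W]
  simp only [condProb_conj_mulVec, meanProb_conj]
  rfl

theorem meanProb_smul (c : ℝ) (E : Op d) : meanProb ((c : ℂ) • E) = c * meanProb E := by
  simp only [meanProb, condProb_smul, integral_const_mul]

theorem infoDensity_smul (c : ℝ) (E : Op d) :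
    infoDensity ((c : ℂ) • E) = c * infoDensity E := by
  rw [infoDensity, infoDensity, ← integral_const_mul]
  congr 1
  ext ψ
  rw [condProb_smul, meanProb_smul]
  by_cases hc : c = 0
  · simp [hc]
  · rw [mul_div_mul_left _ _ hc, mul_assoc]

/-- From `1 - 1/t ≤ log t ≤ t - 1`, multiplied by `t`. -/
theorem abs_mul_log_le {t : ℝ} (ht : 0 ≤ t) : |t * Real.log t| ≤ 1 + t ^ 2 := by
  rcases ht.eq_or_lt with rfl | ht
  · simp
  have h1 := Real.log_le_sub_one_of_pos ht
  have h2 := Real.one_sub_inv_le_log_of_pos ht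
  have h3 : t * (1 - t⁻¹) ≤ t * Real.log t := by gcongr
  rw [mul_sub, mul_inv_cancel₀ ht.ne'] at h3
  have h4 : t * Real.log t ≤ t * (t - 1) := by gcongr
  rw [abs_le]
  constructor <;> nlinarith

/-- The likelihood ratio is at most `d`, since `p(x|ψ) ≤ tr E = d p(x)`. The bound does not depend
on `ψ` and is integrable over outcomes, which justifies Fubini for the information. -/
theorem abs_info_le {E : Op d} (hE : E.PosSemidef) {ψ : Fin d → ℂ} (hψ : star ψ ⬝ᵥ ψ = 1) :
    |condProb E ψ * Real.log (condProb E ψ / meanProb E)| ≤ (1 + (d : ℝ) ^ 2) * E.trace.re := by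
  have hd : (0 : ℝ) < d := Nat.cast_pos.2 (NeZero.pos d)
  have hd1 : (1 : ℝ) ≤ d := Nat.one_le_cast.2 NeZero.one_le
  have hq := condProb_nonneg hE ψ
  have hq' := condProb_le_trace hE hψ
  have hm : E.trace.re = d * meanProb E := by rw [meanProb_eq]; field_simp
  have hm0 := meanProb_nonneg hE
  rcases hm0.eq_or_lt with h0 | hpos
  · have : condProb E ψ = 0 := le_antisymm (by rw [hm, ← h0] at hq'; simpa using hq') hq
    simp [this, hm, ← h0]
  set q := condProb E ψ
  set m := meanProb E
  have ht : 0 ≤ q / m := by positivity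
  have htd : q / m ≤ d := by rw [div_le_iff₀ hpos]; linarith
  have h := abs_mul_log_le ht
  have hqm : q * Real.log (q / m) = m * (q / m * Real.log (q / m)) := by field_simp
  rw [hqm, abs_mul, abs_of_pos hpos]
  calc m * |q / m * Real.log (q / m)| ≤ m * (1 + (d : ℝ) ^ 2) := by
        gcongr
        exact h.trans (by gcongr)
    _ ≤ _ := by
        rw [hm]
        nlinarith [mul_nonneg hpos.le (by positivity : (0 : ℝ) ≤ 1 + (d : ℝ) ^ 2)]

theorem IsPOVM.integrable_info [SFinite ν] (h : IsPOVM ν F) :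
    Integrable (fun z : (Fin d → ℂ) × X =>
      condProb (F z.2) z.1 * Real.log (condProb (F z.2) z.1 / meanProb (F z.2)))
      ((uniformEnsemble d).prod ν) := by
  have hF : ∀ i j, Measurable fun z : (Fin d → ℂ) × X => F z.2 i j := fun i j =>
    (h.measurable i j).comp measurable_snd
  have hq : Measurable fun z : (Fin d → ℂ) × X => condProb (F z.2) z.1 :=
    measurable_condProb hF measurable_fst
  have hm : Measurable fun z : (Fin d → ℂ) × X => meanProb (F z.2) := by
    simp only [meanProb_eq]
    exact (measurable_trace_re hF).div_const _
  refine ((h.integrable_trace.const_mul (1 + (d : ℝ) ^ 2)).comp_snd (uniformEnsemble d)).mono'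
    (hq.mul (Real.measurable_log.comp (hq.div hm))).aestronglyMeasurable ?_
  filter_upwards [Measure.quasiMeasurePreserving_fst.ae ae_unit] with z hz
  exact abs_info_le (h.posSemidef z.2) hz

theorem IsPOVM.information_eq [SFinite ν] (h : IsPOVM ν F) :
    information ν F = ∫ x, infoDensity (F x) ∂ν :=
  integral_integral_swap h.integrable_info

theorem IsPOVM.integrable_infoDensity [SFinite ν] (h : IsPOVM ν F) :
    Integrable (fun x => infoDensity (F x)) ν :=
  h.integrable_info.integral_prod_right

variable {𝒜 : X → Op d → Op d}

theorem IsProcedure.integrable_fidelity [SFinite ν] (h : IsProcedure ν F 𝒜) :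
    Integrable (fun z : (Fin d → ℂ) × X => condProb (𝒜 z.2 (ketbra z.1)) z.1)
      ((uniformEnsemble d).prod ν) := by
  have hA : ∀ k l, Measurable fun z : (Fin d → ℂ) × X => 𝒜 z.2 (ketbra z.1) k l := by
    intro k l
    simp only [fun z : (Fin d → ℂ) × X => (h.compatible z.2).apply_eq_sum (ketbra z.1),
      Matrix.sum_apply, Matrix.smul_apply, smul_eq_mul]
    exact Finset.measurable_sum _ fun i _ => Finset.measurable_sum _ fun j _ =>
      ((measurable_ketbra_apply i j).comp measurable_fst).mul
        ((h.measurable _ k l).comp measurable_snd)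
  refine (h.povm.integrable_trace.comp_snd (uniformEnsemble d)).mono'
    (measurable_condProb hA measurable_fst).aestronglyMeasurable ?_
  filter_upwards [Measure.quasiMeasurePreserving_fst.ae ae_unit] with z hz
  obtain ⟨r, A, hK, hE⟩ := h.compatible z.2
  have hp := hK.posSemidef (posSemidef_ketbra z.1)
  rw [Real.norm_of_nonneg (condProb_nonneg hp _)]
  refine (condProb_le_trace hp hz).trans ?_
  rw [hK.trace_apply, hE]
  exact condProb_le_trace (h.povm.posSemidef _) hz

theorem IsProcedure.disturbance_eq [SFinite ν] (h : IsProcedure ν F 𝒜) :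
    disturbance ν 𝒜 =
      1 - ∫ x, ∫ ψ, condProb (𝒜 x (ketbra ψ)) ψ ∂(uniformEnsemble d) ∂ν := by
  rw [disturbance, ← integral_integral_swap (f := fun ψ x => condProb (𝒜 x (ketbra ψ)) ψ)
    h.integrable_fidelity]
  congr 1
  refine integral_congr_ae ?_
  filter_upwards [ae_unit] with ψ hψ
  refine integral_congr_ae (Filter.Eventually.of_forall fun x => ?_)
  obtain ⟨r, A, hK, -⟩ := h.compatible x
  exact fidelity_ketbra hψ (hK.posSemidef (posSemidef_ketbra ψ))

theorem IsPOVM.disturbance_sqrtDynamics [SFinite ν] (h : IsPOVM ν F) :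
    disturbance ν (sqrtDynamics F) = 1 - ∫ x, optimalFidelity (F x) ∂ν := by
  rw [h.isProcedure_sqrtDynamics.disturbance_eq]
  simp only [sqrtDynamics, integral_fidelity_sqrtOp (h.posSemidef _)]

theorem IsPOVM.integrable_optimalFidelity [SFinite ν] (h : IsPOVM ν F) :
    Integrable (fun x => optimalFidelity (F x)) ν := by
  have := h.isProcedure_sqrtDynamics.integrable_fidelity.integral_prod_right
  simpa only [sqrtDynamics, integral_fidelity_sqrtOp (h.posSemidef _)] using this

/-- The bound on the mean fidelity holds outcome by outcome, so it can be integrated. -/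
theorem IsProcedure.le_disturbance [SFinite ν] (h : IsProcedure ν F 𝒜) :
    1 - ∫ x, optimalFidelity (F x) ∂ν ≤ disturbance ν 𝒜 := by
  have hint : Integrable
      (fun x => ∫ ψ, condProb (𝒜 x (ketbra ψ)) ψ ∂(uniformEnsemble d)) ν :=
    h.integrable_fidelity.integral_prod_right
  rw [h.disturbance_eq]
  exact sub_le_sub_left (integral_mono hint
    h.povm.integrable_optimalFidelity fun x => integral_fidelity_le (h.compatible x)) _

end Densities

/-! ### The Haar twirl. -/

section Twirl

variable {X : Type*} [MeasurableSpace X] {ν : Measure X} {F : X → Op d}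

theorem norm_unitary_apply_le (U : UGroup d) (i j : Fin d) : ‖(U : Op d) i j‖ ≤ 1 :=
  entry_norm_bound_of_unitary U.2 i j

theorem IsPOVM.twirl [SFinite ν] (h : IsPOVM ν F) :
    IsPOVM (twirlMeasure d ν) (twirl F) := by
  have hmeas : ∀ i j, Measurable fun y : X × UGroup d => QuantumMeasurement.twirl F y i j := by
    intro i j
    simp only [QuantumMeasurement.twirl, mul_apply, conjTranspose_apply]
    refine Finset.measurable_sum _ fun k _ =>
      Measurable.mul (Finset.measurable_sum _ fun l _ => ?_) ?_
    · exact ((measurable_unitary_apply i l).comp measurable_snd).mul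
        ((h.measurable l k).comp measurable_fst)
    · exact continuous_star.measurable.comp ((measurable_unitary_apply j k).comp measurable_snd)
  have hint : ∀ i j, Integrable (fun y : X × UGroup d => QuantumMeasurement.twirl F y i j)
      (twirlMeasure d ν) := by
    intro i j
    -- Entries of a unitary have modulus at most one, so this dominates independently of the
    -- unitary, and Haar measure is finite.
    have hb : Integrable (fun y : X × UGroup d => ∑ k, ∑ l, ‖F y.1 l k‖) (twirlMeasure d ν) :=
      integrable_finsetSum _ fun k _ => integrable_finsetSum _ fun l _ =>
        (h.integrable l k).norm.comp_fst _
    refine hb.mono' (hmeas i j).aestronglyMeasurable (Filter.Eventually.of_forall fun y => ?_)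
    simp only [QuantumMeasurement.twirl, mul_apply, conjTranspose_apply, Finset.sum_mul]
    refine norm_sum_le_of_le _ fun k _ => norm_sum_le_of_le _ fun l _ => ?_
    rw [norm_mul, norm_mul, norm_star]
    calc _ ≤ 1 * ‖F y.1 l k‖ * 1 := by
          gcongr <;> exact norm_unitary_apply_le _ _ _
      _ = _ := by ring
  refine ⟨hmeas, fun y => posSemidef_conj y.2 (h.posSemidef y.1), hint, ?_⟩
  ext i j
  simp only [opIntegral, of_apply, twirlMeasure]
  rw [integral_prod_symm _ (hint i j)]
  -- Already for fixed `U` the conjugated effects resolve the identity.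
  have hU : ∀ U : UGroup d, ∫ x, QuantumMeasurement.twirl F (x, U) i j ∂ν = (1 : Op d) i j := by
    intro U
    have := congrFun₂ (opIntegral_mul_mul h.integrable (U : Op d) (U : Op d)ᴴ) i j
    rwa [h.integral_eq_one, Matrix.mul_one, coe_mul_conjTranspose] at this
  simp [hU]

theorem integral_comp_fst_twirlMeasure [SFinite ν] (f : X → ℝ) :
    ∫ y, f y.1 ∂(twirlMeasure d ν) = ∫ x, f x ∂ν := by
  rw [twirlMeasure, integral_fun_fst]
  simp

instance sFinite_twirlMeasure [SFinite ν] : SFinite (twirlMeasure d ν) := by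
  unfold twirlMeasure
  infer_instance

theorem IsPOVM.integral_optimalFidelity_twirl [SFinite ν] (h : IsPOVM ν F) :
    ∫ y, optimalFidelity (QuantumMeasurement.twirl F y) ∂(twirlMeasure d ν) =
      ∫ x, optimalFidelity (F x) ∂ν := by
  simp only [QuantumMeasurement.twirl, optimalFidelity_conj _ (h.posSemidef _)]
  exact integral_comp_fst_twirlMeasure fun x => optimalFidelity (F x)

theorem IsPOVM.information_twirl [NeZero d] [SFinite ν] (h : IsPOVM ν F) :
    information (twirlMeasure d ν) (QuantumMeasurement.twirl F) = information ν F := by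
  rw [h.twirl.information_eq, h.information_eq]
  simp only [QuantumMeasurement.twirl, infoDensity_conj]
  exact integral_comp_fst_twirlMeasure fun x => infoDensity (F x)

end Twirl

/-! ### Covariant channels are depolarizing maps. -/

section Covariance

theorem isUnitarilyCovariant_iff {𝒜 : Op d → Op d} :
    IsUnitarilyCovariant 𝒜 ↔ ∀ (W : UGroup d) (ρ : Op d),
      𝒜 ((W : Op d) * ρ * (W : Op d)ᴴ) = (W : Op d) * 𝒜 ρ * (W : Op d)ᴴ := by
  refine forall_congr' fun W => forall_congr' fun ρ => ⟨fun h => ?_, fun h => ?_⟩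
  · rw [← h]
    calc _ = ((W : Op d) * (W : Op d)ᴴ) * 𝒜 ((W : Op d) * ρ * (W : Op d)ᴴ) *
          ((W : Op d) * (W : Op d)ᴴ) := by
          rw [coe_mul_conjTranspose, Matrix.one_mul, Matrix.mul_one]
      _ = _ := by simp only [Matrix.mul_assoc]
  · rw [h]
    calc _ = ((W : Op d)ᴴ * (W : Op d)) * 𝒜 ρ * ((W : Op d)ᴴ * (W : Op d)) := by
          simp only [Matrix.mul_assoc]
      _ = _ := by rw [conjTranspose_mul_coe, Matrix.one_mul, Matrix.mul_one]

theorem isUnitarilyCovariant_depolarizing (p : ℝ) :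
    IsUnitarilyCovariant (depolarizing p : Op d → Op d) := by
  rw [isUnitarilyCovariant_iff]
  intro W ρ
  rw [depolarizing, depolarizing, trace_conj, Matrix.mul_add, Matrix.add_mul, Matrix.mul_smul,
    Matrix.smul_mul, Matrix.mul_smul, Matrix.smul_mul, Matrix.mul_one, coe_mul_conjTranspose]

/-- The trace condition gives `a + b d = 1` and the functional `s` gives `a d² + b d = s`; then `p =
1 - a`. For `d = 1` the equations degenerate: `s = 1`, and `p = 0` is one valid choice. -/
theorem exists_eq_depolarizing [NeZero d] (𝒜 : Op d →ₗ[ℂ] Op d)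
    (hcov : ∀ (W : UGroup d) (ρ : Op d),
      𝒜 ((W : Op d) * ρ * (W : Op d)ᴴ) = (W : Op d) * 𝒜 ρ * (W : Op d)ᴴ)
    (htr : ∀ ρ, (𝒜 ρ).trace = ρ.trace) {s : ℝ}
    (hs : ∑ i, ∑ j, 𝒜 (single i j 1) i j = s) (hsd : s ≤ (d : ℝ) ^ 2) :
    ∃ p : ℝ, 0 ≤ p ∧ p * ((d : ℝ) ^ 2 - 1) = (d : ℝ) ^ 2 - s ∧ (1 ≤ s → p ≤ 1) ∧
      ∀ ρ, 𝒜 ρ = depolarizing p ρ := by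
  obtain ⟨a, b, hab⟩ := exists_eq_of_covariant 𝒜 hcov
  have hd : (d : ℂ) ≠ 0 := Nat.cast_ne_zero.2 (NeZero.ne d)
  have h1 : a + b * d = 1 := by
    have h := htr (single 0 0 1)
    rw [hab] at h
    simpa using h
  have h2 : a * d ^ 2 + b * d = s := by
    rw [← hs]
    have : ∀ i j : Fin d, 𝒜 (single i j 1) i j = a + if i = j then b else 0 := by
      intro i j
      rw [hab]
      by_cases hij : i = j
      · subst hij; simp
      · simp [hij]
    simp only [this, Finset.sum_add_distrib, Finset.sum_const, Finset.card_univ, Fintype.card_fin,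
      Finset.sum_ite_eq, Finset.mem_univ, if_true, nsmul_eq_mul]
    ring
  have hb : b = (1 - a) / d := by field_simp; linear_combination h1
  rcases Nat.lt_or_ge 1 d with hd2 | hd2
  · have hd2' : (1 : ℝ) < d := Nat.one_lt_cast.2 hd2
    have hpos : 0 < (d : ℝ) ^ 2 - 1 := by nlinarith
    have hposC : (d : ℂ) ^ 2 - 1 ≠ 0 := by exact_mod_cast hpos.ne'
    have ha : 1 - a = (((d : ℝ) ^ 2 - s) / ((d : ℝ) ^ 2 - 1) : ℝ) := by
      push_cast
      rw [eq_div_iff hposC]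
      linear_combination h1 - h2
    refine ⟨((d : ℝ) ^ 2 - s) / ((d : ℝ) ^ 2 - 1), div_nonneg (by linarith) hpos.le,
      div_mul_cancel₀ _ hpos.ne', fun h => (div_le_one hpos).2 (by linarith), fun ρ => ?_⟩
    rw [hab, depolarizing, hb]
    have ha' : a = 1 - (((d : ℝ) ^ 2 - s) / ((d : ℝ) ^ 2 - 1) : ℝ) := by rw [← ha]; ring
    rw [ha']
    push_cast
    simp only [sub_sub_cancel]
  · obtain rfl : d = 1 := le_antisymm hd2 NeZero.one_le
    have hs1 : s = 1 := by
      have : (s : ℂ) = 1 := by rw [← h2, ← h1]; push_cast; ring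
      exact_mod_cast this
    refine ⟨0, le_rfl, by simp [hs1], fun _ => zero_le_one, fun ρ => ?_⟩
    have hρ : ρ = ρ.trace • 1 := by
      ext i j
      rw [Subsingleton.elim i 0, Subsingleton.elim j 0]
      simp [trace]
    have h1' : a + b = 1 := by simpa using h1
    rw [hab, depolarizing]
    simp only [sub_zero, Complex.ofReal_one, one_smul, zero_div, Complex.ofReal_zero, zero_mul,
      zero_smul, add_zero]
    conv_rhs => rw [hρ]
    conv_lhs => enter [1]; rw [hρ]
    rw [smul_smul, ← add_smul]
    congr 1
    linear_combination ρ.trace * h1'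

/-- The summand is `A i i` times the conjugate of `A j j`. Thus the functional `s` of a Kraus map is
`∑ |tr A k|²`, the quantity that also governs the average fidelity. -/
theorem sum_conj_single_apply (A : Op d) :
    ∑ i, ∑ j, (A * single i j (1 : ℂ) * Aᴴ : Op d) i j = Complex.normSq A.trace := by
  have h : ∀ i j, (A * single i j (1 : ℂ) * Aᴴ : Op d) i j = A i i * star (A j j) := fun i j => by
    simp [mul_apply, single_apply, ite_and]
  simp only [h]
  rw [← Complex.mul_conj]
  simp only [trace, diag, map_sum, Finset.sum_mul_sum]
  rfl

/-- Cauchy–Schwarz for the Hilbert–Schmidt pairing with the identity. Summed over a channel's Kraus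
operators, it gives `s ≤ d²`. -/
theorem normSq_trace_le (A : Op d) :
    Complex.normSq A.trace ≤ d * (Aᴴ * A).trace.re := by
  have h1 : ‖A.trace‖ ≤ ∑ i, ‖A i i‖ := norm_sum_le _ _
  have h2 : (∑ i, ‖A i i‖) ^ 2 ≤ d * ∑ i, ‖A i i‖ ^ 2 := by
    simpa using sq_sum_le_card_mul_sum_sq (s := Finset.univ) (f := fun i => ‖A i i‖)
  have h3 : ∑ i, ‖A i i‖ ^ 2 ≤ (Aᴴ * A).trace.re := by
    simp only [trace, diag, Complex.re_sum, mul_apply, conjTranspose_apply]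
    refine Finset.sum_le_sum fun i _ => ?_
    refine le_trans (le_of_eq ?_) (Finset.single_le_sum (f := fun k =>
      (star (A k i) * A k i).re) (fun k _ => ?_) (Finset.mem_univ i))
    · simp [← Complex.normSq_eq_norm_sq, Complex.normSq_apply]
    · simp only [Complex.star_def, Complex.mul_re, Complex.conj_re, Complex.conj_im]
      nlinarith [mul_self_nonneg (A k i).re, mul_self_nonneg (A k i).im]
  rw [Complex.normSq_eq_norm_sq]
  calc ‖A.trace‖ ^ 2 ≤ (∑ i, ‖A i i‖) ^ 2 := by gcongr
    _ ≤ _ := h2.trans (by gcongr)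

theorem isUnitarilyCovariant_channel_iff [NeZero d] {𝒜 : Op d → Op d} (h : IsChannel 𝒜) :
    IsUnitarilyCovariant 𝒜 ↔
      ∃ p : ℝ, 0 ≤ p ∧ p * ((d : ℝ) ^ 2 - 1) ≤ (d : ℝ) ^ 2 ∧ 𝒜 = depolarizing p := by
  refine ⟨fun hcov => ?_, ?_⟩
  · obtain ⟨r, A, hA, hE⟩ := h
    let L : Op d →ₗ[ℂ] Op d :=
      { toFun := 𝒜
        map_add' := fun ρ σ => by
          simp only [hA _, Matrix.mul_add, Matrix.add_mul, Finset.sum_add_distrib]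
        map_smul' := fun c ρ => by
          simp only [hA _, Matrix.mul_smul, Matrix.smul_mul, Finset.smul_sum, RingHom.id_apply] }
    have hs : ∑ i, ∑ j, L (single i j 1) i j =
        ((∑ k, Complex.normSq (A k).trace : ℝ) : ℂ) := by
      change ∑ i, ∑ j, 𝒜 (single i j 1) i j = _
      simp only [hA _, Matrix.sum_apply, Complex.ofReal_sum, ← sum_conj_single_apply]
      conv_rhs => rw [Finset.sum_comm]
      exact Finset.sum_congr rfl fun i _ => Finset.sum_comm
    have hsd : ∑ k, Complex.normSq (A k).trace ≤ (d : ℝ) ^ 2 := by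
      calc _ ≤ ∑ k, d * ((A k)ᴴ * A k).trace.re :=
            Finset.sum_le_sum fun k _ => normSq_trace_le (A k)
        _ = d * (∑ k, (A k)ᴴ * A k).trace.re := by
            rw [← Finset.mul_sum, trace_sum, Complex.re_sum]
        _ = _ := by rw [hE, trace_one, Fintype.card_fin, Complex.natCast_re, sq]
    obtain ⟨p, hp, hps, -, hpA⟩ := exists_eq_depolarizing L (isUnitarilyCovariant_iff.1 hcov)
      (fun ρ => by
        change (𝒜 ρ).trace = _
        rw [hA.trace_apply, hE, Matrix.one_mul]) hs hsd
    refine ⟨p, hp, ?_, funext hpA⟩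
    -- `s ≤ d²` gave `0 ≤ p`; the upper constraint on `p` is `0 ≤ s`.
    rw [hps, sub_le_self_iff]
    exact Finset.sum_nonneg fun k _ => Complex.normSq_nonneg _
  · rintro ⟨p, -, -, rfl⟩
    exact isUnitarilyCovariant_depolarizing p

end Covariance

/-! ### The overall operation of the square-root dynamics. -/

section OverallOperation

variable {X : Type*} [MeasurableSpace X] {ν : Measure X} {F : X → Op d}

/-- The trace of `E` is the squared Hilbert–Schmidt norm of its root. Products of two entries of the
root are therefore dominated by the integrable trace. -/
theorem norm_sqrtOp_apply_sq_le {E : Op d} (hE : E.PosSemidef) (i j : Fin d) :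
    ‖sqrtOp E i j‖ ^ 2 ≤ E.trace.re := by
  have h : E.trace.re = ∑ k, ∑ l, ‖sqrtOp E k l‖ ^ 2 := by
    conv_lhs => rw [← sqrtOp_mul_self hE]
    conv_lhs => enter [1, 1, 2]; rw [← (posSemidef_sqrtOp hE).isHermitian.eq]
    simp only [trace, diag, Complex.re_sum, mul_apply, conjTranspose_apply]
    refine Finset.sum_congr rfl fun k _ => Finset.sum_congr rfl fun l _ => ?_
    simp [← Complex.normSq_eq_norm_sq, Complex.normSq_apply]
  rw [h]
  exact (Finset.single_le_sum (f := fun l => ‖sqrtOp E i l‖ ^ 2) (fun _ _ => by positivity)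
    (Finset.mem_univ j)).trans (Finset.single_le_sum (f := fun k => ∑ l, ‖sqrtOp E k l‖ ^ 2)
    (fun _ _ => by positivity) (Finset.mem_univ i))

theorem IsPOVM.integrable_sqrtDynamics (h : IsPOVM ν F) (ρ : Op d) (i j : Fin d) :
    Integrable (fun x => sqrtDynamics F x ρ i j) ν := by
  have hb : Integrable (fun x => ∑ k, ∑ l, (F x).trace.re * ‖ρ l k‖) ν :=
    integrable_finsetSum _ fun k _ => integrable_finsetSum _ fun l _ =>
      h.integrable_trace.mul_const _
  refine hb.mono' (h.isProcedure_sqrtDynamics.measurable ρ i j).aestronglyMeasurable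
    (Filter.Eventually.of_forall fun x => ?_)
  simp only [sqrtDynamics, mul_apply, Finset.sum_mul]
  refine norm_sum_le_of_le _ fun k _ => norm_sum_le_of_le _ fun l _ => ?_
  rw [norm_mul, norm_mul, mul_right_comm]
  gcongr
  have h1 := norm_sqrtOp_apply_sq_le (h.posSemidef x) i l
  have h2 := norm_sqrtOp_apply_sq_le (h.posSemidef x) k j
  nlinarith [sq_nonneg (‖sqrtOp (F x) i l‖ - ‖sqrtOp (F x) k j‖)]

/-- The overall operation of the square-root dynamics, as a linear map. -/
noncomputable def IsPOVM.overallSqrt (h : IsPOVM ν F) : Op d →ₗ[ℂ] Op d where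
  toFun := overallOperation ν (sqrtDynamics F)
  map_add' ρ σ := by
    rw [overallOperation, overallOperation, overallOperation,
      ← opIntegral_add (h.integrable_sqrtDynamics ρ) (h.integrable_sqrtDynamics σ)]
    simp only [sqrtDynamics, Matrix.mul_add, Matrix.add_mul]
  map_smul' c ρ := by
    rw [overallOperation, overallOperation, RingHom.id_apply, ← opIntegral_smul]
    simp only [sqrtDynamics, Matrix.mul_smul, Matrix.smul_mul]

theorem IsPOVM.trace_overallSqrt (h : IsPOVM ν F) (ρ : Op d) :
    (overallOperation ν (sqrtDynamics F) ρ).trace = ρ.trace := by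
  have h1 := opIntegral_mul_mul h.integrable 1 ρ
  have hint : ∀ i j, Integrable (fun x => (F x * ρ) i j) ν := fun i j => by
    simp only [mul_apply]
    exact integrable_finsetSum _ fun k _ => (h.integrable i k).mul_const _
  rw [overallOperation, trace_opIntegral (h.integrable_sqrtDynamics ρ)]
  have h2 := trace_opIntegral hint
  simp only [Matrix.one_mul, h.integral_eq_one] at h1
  rw [h1] at h2
  rw [h2]
  congr 1
  ext x
  rw [sqrtDynamics, Matrix.trace_mul_cycle, sqrtOp_mul_self (h.posSemidef x)]

theorem sum_sqrtDynamics_single {E : Op d} (hE : E.PosSemidef) :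
    ∑ i, ∑ j, (sqrtOp E * single i j (1 : ℂ) * sqrtOp E : Op d) i j =
      (((sqrtOp E).trace.re ^ 2 : ℝ) : ℂ) := by
  have hS := posSemidef_sqrtOp hE
  have h := sum_conj_single_apply (sqrtOp E)
  rw [hS.isHermitian.eq] at h
  rw [h, Complex.normSq_apply, (Complex.nonneg_iff.1 hS.trace_nonneg).2.symm]
  congr 1
  ring

theorem trace_sqrtOp_sq_le {E : Op d} (hE : E.PosSemidef) :
    (sqrtOp E).trace.re ^ 2 ≤ d * E.trace.re := by
  have hS := posSemidef_sqrtOp hE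
  have h := normSq_trace_le (sqrtOp E)
  rw [hS.isHermitian.eq, sqrtOp_mul_self hE, Complex.normSq_apply,
    (Complex.nonneg_iff.1 hS.trace_nonneg).2.symm] at h
  linarith [sq (sqrtOp E).trace.re]

theorem le_trace_sqrtOp_sq {E : Op d} (hE : E.PosSemidef) :
    E.trace.re ≤ (sqrtOp E).trace.re ^ 2 := by
  obtain ⟨V, l, hl, rfl⟩ := exists_diagonalization hE
  rw [sqrtOp_conj V (posSemidef_diagonal_ofReal hl), trace_conj, trace_conj, sqrtOp_diagonal hl,
    trace_diagonal, trace_diagonal, ← Complex.ofReal_sum, ← Complex.ofReal_sum, Complex.ofReal_re,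
    Complex.ofReal_re]
  calc ∑ i, l i = ∑ i, Real.sqrt (l i) ^ 2 :=
        Finset.sum_congr rfl fun i _ => (Real.sq_sqrt (hl i)).symm
    _ ≤ _ := Finset.sum_sq_le_sq_sum_of_nonneg fun i _ => Real.sqrt_nonneg _

theorem IsPOVM.integrable_trace_sqrtOp_sq (h : IsPOVM ν F) :
    Integrable (fun x => (sqrtOp (F x)).trace.re ^ 2) ν := by
  refine (h.integrable_trace.const_mul (d : ℝ)).mono' ((measurable_trace_re (F := fun x =>
    sqrtOp (F x)) (measurable_sqrtOp h.measurable h.posSemidef)).pow_const 2).aestronglyMeasurable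
    (Filter.Eventually.of_forall fun x => ?_)
  rw [Real.norm_of_nonneg (sq_nonneg _)]
  exact trace_sqrtOp_sq_le (h.posSemidef x)

/-- Here `s = ∫ (tr √F)²`. Integrating `tr E ≤ (tr √E)² ≤ d tr E` yields `d ≤ s ≤ d²`; the lower
bound, in the weaker form `1 ≤ s`, gives `p ≤ 1`. -/
theorem IsPOVM.exists_overallSqrt_eq_depolarizing [NeZero d] (h : IsPOVM ν F)
    (hcov : IsUnitarilyCovariant (overallOperation ν (sqrtDynamics F))) :
    ∃ p ∈ Set.Icc (0 : ℝ) 1, overallOperation ν (sqrtDynamics F) = depolarizing p := by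
  have hs : ∑ i, ∑ j, h.overallSqrt (single i j 1) i j =
      ((∫ x, (sqrtOp (F x)).trace.re ^ 2 ∂ν : ℝ) : ℂ) := by
    change ∑ i, ∑ j, ∫ x, sqrtDynamics F x (single i j 1) i j ∂ν = _
    rw [← integral_complex_ofReal]
    simp only [← sum_sqrtDynamics_single (h.posSemidef _)]
    change _ = ∫ x, ∑ i, ∑ j, sqrtDynamics F x (single i j 1) i j ∂ν
    rw [integral_finsetSum _ fun i _ => integrable_finsetSum _ fun j _ =>
      h.integrable_sqrtDynamics (single i j 1) i j]
    refine Finset.sum_congr rfl fun i _ => ?_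
    rw [integral_finsetSum _ fun j _ => h.integrable_sqrtDynamics (single i j 1) i j]
  have hub : ∫ x, (sqrtOp (F x)).trace.re ^ 2 ∂ν ≤ (d : ℝ) ^ 2 := by
    calc _ ≤ ∫ x, d * (F x).trace.re ∂ν :=
          integral_mono h.integrable_trace_sqrtOp_sq (h.integrable_trace.const_mul _) fun x =>
            trace_sqrtOp_sq_le (h.posSemidef x)
      _ = _ := by rw [integral_const_mul, h.integral_trace, sq]
  have hlb : 1 ≤ ∫ x, (sqrtOp (F x)).trace.re ^ 2 ∂ν :=
    calc (1 : ℝ) ≤ d := Nat.one_le_cast.2 NeZero.one_le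
      _ = ∫ x, (F x).trace.re ∂ν := h.integral_trace.symm
      _ ≤ _ := integral_mono h.integrable_trace h.integrable_trace_sqrtOp_sq fun x =>
        le_trace_sqrtOp_sq (h.posSemidef x)
  obtain ⟨p, hp0, -, hp1, hp⟩ := exists_eq_depolarizing h.overallSqrt
    (isUnitarilyCovariant_iff.1 hcov) h.trace_overallSqrt hs hub
  exact ⟨p, ⟨hp0, hp1 hlb⟩, funext hp⟩

theorem IsPOVM.isUnitarilyCovariant_overall_twirl [SFinite ν] (h : IsPOVM ν F) :
    IsUnitarilyCovariant
      (overallOperation (twirlMeasure d ν) (sqrtDynamics (QuantumMeasurement.twirl F))) := by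
  rw [isUnitarilyCovariant_iff]
  intro W ρ
  have hint := h.twirl.integrable_sqrtDynamics
  have hW : ∀ (x : X) (U : UGroup d),
      sqrtDynamics (QuantumMeasurement.twirl F) (x, W * U) ((W : Op d) * ρ * (W : Op d)ᴴ) =
        (W : Op d) * sqrtDynamics (QuantumMeasurement.twirl F) (x, U) ρ * (W : Op d)ᴴ := by
    intro x U
    have h1 : QuantumMeasurement.twirl F (x, W * U) =
        (W : Op d) * QuantumMeasurement.twirl F (x, U) * (W : Op d)ᴴ := by
      simp only [QuantumMeasurement.twirl, Submonoid.coe_mul, conjTranspose_mul, Matrix.mul_assoc]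
    rw [sqrtDynamics, sqrtDynamics, h1, sqrtOp_conj W (h.twirl.posSemidef _), conj_mul_conj,
      conj_mul_conj]
  rw [overallOperation, overallOperation, ← opIntegral_mul_mul (hint ρ)]
  ext i j
  simp only [opIntegral, of_apply, twirlMeasure]
  rw [integral_prod _ (hint _ i j), integral_prod]
  · congr 1
    ext x
    -- Substituting `W * U` for `U` moves the conjugation by `W` outside the operation.
    rw [← integral_mul_left_eq_self _ W]
    simp only [hW]
  · simp only [mul_apply, Finset.sum_mul]
    exact integrable_finsetSum _ fun k _ => integrable_finsetSum _ fun l _ =>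
      ((hint ρ l k).const_mul _).mul_const _

end OverallOperation

/-! ### Entropies of finite POVMs. -/

section FiniteEntropy

theorem continuous_condProb (E : Op d) : Continuous (condProb E) :=
  Complex.continuous_re.comp (continuous_trace_mul_ketbra E)

variable [NeZero d]

theorem condProb_eq_zero_of_meanProb_eq_zero {E : Op d} (hE : E.PosSemidef)
    (h : meanProb E = 0) (ψ : Fin d → ℂ) : condProb E ψ = 0 := by
  have hd : (d : ℝ) ≠ 0 := Nat.cast_ne_zero.2 (NeZero.ne d)
  rw [meanProb_eq, div_eq_zero_iff, or_iff_left hd] at h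
  have h0 : E = 0 := by
    rw [← hE.trace_eq_zero_iff]
    exact Complex.ext h (Complex.nonneg_iff.1 hE.trace_nonneg).2.symm
  simp [condProb, h0]

theorem integrable_negMulLog_condProb (E : Op d) :
    Integrable (fun ψ => Real.negMulLog (condProb E ψ)) (uniformEnsemble d) :=
  integrable_uniformEnsemble_of_continuous
    (Real.continuous_negMulLog.comp (continuous_condProb E))

theorem infoDensity_eq {E : Op d} (hE : E.PosSemidef) :
    infoDensity E = Real.negMulLog (meanProb E) -
      ∫ ψ, Real.negMulLog (condProb E ψ) ∂(uniformEnsemble d) := by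
  have h1 : ∀ ψ, condProb E ψ * Real.log (condProb E ψ / meanProb E) =
      -Real.log (meanProb E) * condProb E ψ - Real.negMulLog (condProb E ψ) := by
    intro ψ
    by_cases hq : condProb E ψ = 0
    · simp [hq]
    -- The logarithm of the quotient may be split: a vanishing mean probability would make the
    -- effect zero.
    have hm : meanProb E ≠ 0 := fun h => hq (condProb_eq_zero_of_meanProb_eq_zero hE h ψ)
    rw [Real.log_div hq hm, Real.negMulLog]
    ring
  rw [infoDensity]
  simp only [h1]
  rw [integral_sub ((integrable_uniformEnsemble_of_continuous (continuous_condProb E)).const_mul _)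
    (integrable_negMulLog_condProb E), integral_const_mul]
  rw [← meanProb, Real.negMulLog]
  ring

theorem information_count_eq {n : ℕ} {F : Fin n → Op d} (h : IsPOVM Measure.count F) :
    information Measure.count F = ∑ b, infoDensity (F b) := by
  rw [h.information_eq, integral_count]

theorem information_eq_outcomeEntropy_sub {n : ℕ} {F : Fin n → Op d}
    (h : IsPOVM Measure.count F) :
    information Measure.count F = outcomeEntropy F - condOutcomeEntropy F := by
  rw [information_count_eq h, outcomeEntropy, condOutcomeEntropy, integral_finsetSum _ fun b _ =>
    integrable_negMulLog_condProb (F b), ← Finset.sum_sub_distrib]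
  exact Finset.sum_congr rfl fun b _ => infoDensity_eq (h.posSemidef b)

end FiniteEntropy

/-! ### Compact convex hulls and averages in finite dimension. -/

section ConvexHull

/-- Carathéodory: `finrank + 1` points suffice, so the hull is a continuous image of a simplex times
a power of `K`. Shorter combinations are padded with zero weights and a repeated point `z i₀`. -/
theorem isCompact_convexHull_of_finrank {E : Type*} [NormedAddCommGroup E] [NormedSpace ℝ E]
    [FiniteDimensional ℝ E] {K : Set E} (hK : IsCompact K) : IsCompact (convexHull ℝ K) := by
  let N := Module.finrank ℝ E + 1
  let f : (Fin N → ℝ) × (Fin N → E) → E := fun z => ∑ i, z.1 i • z.2 i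
  have hf : Continuous f := by fun_prop
  have hS : IsCompact (stdSimplex ℝ (Fin N) ×ˢ Set.univ.pi fun _ : Fin N => K) :=
    (isCompact_stdSimplex ℝ (Fin N)).prod (isCompact_univ_pi fun _ => hK)
  convert hS.image hf
  refine Set.Subset.antisymm (fun x hx => ?_) ?_
  · obtain ⟨ι, _, z, w, hz, hind, hw, hw1, hx⟩ := eq_pos_convex_span_of_mem_convexHull hx
    have hcard : Fintype.card ι ≤ Fintype.card (Fin N) := by
      rw [Fintype.card_fin]
      exact hind.card_le_finrank_succ.trans (Nat.succ_le_succ (Submodule.finrank_le _))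
    obtain ⟨e⟩ := Function.Embedding.nonempty_of_card_le hcard
    have hne : Nonempty ι := by
      by_contra hne
      rw [not_nonempty_iff] at hne
      simp at hw1
    obtain ⟨i₀⟩ := hne
    have hext : ∀ i, Function.extend e w (0 : Fin N → ℝ) (e i) = w i := e.injective.extend_apply w _
    have hext0 : ∀ j ∉ Set.range e, Function.extend e w (0 : Fin N → ℝ) j = 0 := fun j hj =>
      Function.extend_apply' w _ j fun ⟨i, hi⟩ => hj ⟨i, hi⟩
    refine ⟨(Function.extend e w (0 : Fin N → ℝ), Function.extend e z fun _ => z i₀),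
      ⟨⟨fun j => ?_, ?_⟩, fun j _ => ?_⟩, ?_⟩
    · by_cases hj : j ∈ Set.range e
      · obtain ⟨i, rfl⟩ := hj
        exact (hw i).le.trans (hext i).ge
      · exact (hext0 j hj).ge
    · rw [← hw1]
      exact (Fintype.sum_of_injective e e.injective w _ hext0 fun i => (hext i).symm).symm
    · by_cases hj : ∃ i, e i = j
      · obtain ⟨i, rfl⟩ := hj
        simpa only [e.injective.extend_apply] using hz ⟨i, rfl⟩
      · simpa only [Function.extend_apply' _ _ _ hj] using hz ⟨i₀, rfl⟩
    · rw [← hx]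
      refine (Fintype.sum_of_injective e e.injective (fun i => w i • z i) _ (fun j hj => ?_)
        fun i => ?_).symm
      · simp only [hext0 j hj, zero_smul]
      · simp only [hext, e.injective.extend_apply]
  · rintro _ ⟨⟨w, z⟩, ⟨hw, hz⟩, rfl⟩
    exact (convex_convexHull ℝ K).sum_mem (fun i _ => hw.1 i) hw.2
      fun i _ => subset_convexHull ℝ K (hz i (Set.mem_univ i))

/-- An integral of vectors in the cone over `K` lies in the cone over the convex hull of `K`. -/
theorem integral_mem_smul_convexHull {X : Type*} [MeasurableSpace X] {ν : Measure X}
    {E : Type*} [NormedAddCommGroup E] [NormedSpace ℝ E] [FiniteDimensional ℝ E] {K : Set E}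
    (hK : IsCompact K) {t : X → ℝ} {v : X → E} (ht : Integrable t ν) (hv : Integrable v ν)
    (ht0 : ∀ x, 0 ≤ t x) (h : ∀ x, ∃ k ∈ K, v x = t x • k) (hpos : 0 < ∫ x, t x ∂ν) :
    (∫ x, t x ∂ν)⁻¹ • ∫ x, v x ∂ν ∈ convexHull ℝ K := by
  by_contra hn
  -- A functional separating the average from the closed hull satisfies `l (v x) ≤ u * t x`
  -- pointwise; integration contradicts the separation. No measurable choice of the points `k` is
  -- required.
  obtain ⟨l, u, hl, hu⟩ := geometric_hahn_banach_closed_point (convex_convexHull ℝ K)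
    (isCompact_convexHull_of_finrank hK).isClosed hn
  have h1 : ∀ x, l (v x) ≤ u * t x := by
    intro x
    obtain ⟨k, hk, hvx⟩ := h x
    rw [hvx, map_smul, smul_eq_mul, mul_comm]
    exact mul_le_mul_of_nonneg_right (hl k (subset_convexHull ℝ K hk)).le (ht0 x)
  have h2 := integral_mono (l.integrable_comp hv) (ht.const_mul u) h1
  rw [ContinuousLinearMap.integral_comp_comm l hv, integral_const_mul] at h2
  rw [map_smul, smul_eq_mul, lt_inv_mul_iff₀ hpos] at hu
  linarith [mul_comm u (∫ x, t x ∂ν)]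

end ConvexHull

/-! ### The attainable region of information and fidelity. -/

section Simplex

theorem isPOVM_count {n : ℕ} {G : Fin n → Op d} (hG : ∀ b, (G b).PosSemidef)
    (h1 : ∑ b, G b = 1) : IsPOVM Measure.count G where
  measurable _ _ := measurable_of_finite _
  posSemidef := hG
  integrable _ _ := Integrable.of_finite
  integral_eq_one := by
    rw [← h1]
    ext i j
    simp only [opIntegral, of_apply, integral_count, Matrix.sum_apply]

/-- The operator with the given eigenvalues in the standard basis. -/
def diagOp (l : Fin d → ℝ) : Op d := diagonal fun i => (l i : ℂ)

theorem posSemidef_diagOp {l : Fin d → ℝ} (hl : ∀ i, 0 ≤ l i) : (diagOp l).PosSemidef :=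
  posSemidef_diagonal_ofReal hl

theorem trace_diagOp (l : Fin d → ℝ) : (diagOp l).trace.re = ∑ i, l i := by
  rw [diagOp, trace_diagonal, ← Complex.ofReal_sum, Complex.ofReal_re]

theorem condProb_diagOp (l : Fin d → ℝ) (ψ : Fin d → ℂ) :
    condProb (diagOp l) ψ = ∑ i, l i * ‖ψ i‖ ^ 2 := by
  rw [condProb, trace_mul_ketbra, diagOp]
  simp only [dotProduct, mulVec_diagonal, Pi.star_apply, Complex.re_sum]
  refine Finset.sum_congr rfl fun i _ => ?_
  rw [← Complex.normSq_eq_norm_sq, Complex.normSq_apply]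
  simp
  ring

theorem continuousOn_optimalFidelity_diagOp :
    ContinuousOn (fun l : Fin d → ℝ => optimalFidelity (diagOp l)) (stdSimplex ℝ (Fin d)) := by
  have h : Set.EqOn (fun l : Fin d → ℝ => optimalFidelity (diagOp l))
      (fun l => (∑ i, l i + (∑ i, Real.sqrt (l i)) ^ 2) / (d * (d + 1)))
      (stdSimplex ℝ (Fin d)) := by
    intro l hl
    simp only [optimalFidelity, trace_diagOp]
    rw [diagOp, sqrtOp_diagonal hl.1, trace_diagonal, ← Complex.ofReal_sum, Complex.ofReal_re]
  refine ContinuousOn.congr (Continuous.continuousOn ?_) h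
  fun_prop

variable [NeZero d]

/-- On the simplex the mean probability is the constant `1 / d`, so only the conditional entropy
varies. Probabilities lie in `[0, 1]` there, whence the dominating constant `2`. -/
theorem continuousOn_infoDensity_diagOp :
    ContinuousOn (fun l : Fin d → ℝ => infoDensity (diagOp l)) (stdSimplex ℝ (Fin d)) := by
  have h : Set.EqOn (fun l : Fin d → ℝ => infoDensity (diagOp l))
      (fun l => Real.negMulLog (d : ℝ)⁻¹ -
        ∫ ψ, Real.negMulLog (∑ i, l i * ‖ψ i‖ ^ 2) ∂(uniformEnsemble d))
      (stdSimplex ℝ (Fin d)) := by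
    intro l hl
    simp only [infoDensity_eq (posSemidef_diagOp hl.1), meanProb_eq, trace_diagOp, hl.2,
      condProb_diagOp, one_div]
  refine ContinuousOn.congr (continuousOn_const.sub ?_) h
  refine continuousOn_of_dominated (bound := fun _ => 2) (fun l _ => ?_) (fun l hl => ?_)
    (integrable_const _) (Filter.Eventually.of_forall fun ψ => ?_)
  · exact (Real.continuous_negMulLog.comp (by fun_prop)).aestronglyMeasurable
  · filter_upwards [ae_unit] with ψ hψ
    have h0 := condProb_nonneg (posSemidef_diagOp hl.1) ψ
    have h1 := condProb_le_trace (posSemidef_diagOp hl.1) hψ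
    rw [trace_diagOp, hl.2] at h1
    rw [← condProb_diagOp, Real.negMulLog, Real.norm_eq_abs, neg_mul, abs_neg]
    refine (abs_mul_log_le h0).trans ?_
    nlinarith
  · exact (Real.continuous_negMulLog.comp (by fun_prop)).continuousOn

/-- The information density of an effect, together with its optimal fidelity. -/
noncomputable def infoFidelity (E : Op d) : ℝ × ℝ := (infoDensity E, optimalFidelity E)

theorem infoFidelity_conj (W : UGroup d) {E : Op d} (hE : E.PosSemidef) :
    infoFidelity ((W : Op d) * E * (W : Op d)ᴴ) = infoFidelity E := by
  rw [infoFidelity, infoDensity_conj, optimalFidelity_conj W hE, infoFidelity]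

theorem infoFidelity_smul {c : ℝ} (hc : 0 ≤ c) {E : Op d} (hE : E.PosSemidef) :
    infoFidelity ((c : ℂ) • E) = c • infoFidelity E := by
  rw [infoFidelity, infoDensity_smul, optimalFidelity_smul hc hE, infoFidelity, Prod.smul_mk,
    smul_eq_mul, smul_eq_mul]

theorem isCompact_image_infoFidelity :
    IsCompact ((fun l : Fin d → ℝ => infoFidelity (diagOp l)) '' stdSimplex ℝ (Fin d)) :=
  (isCompact_stdSimplex ℝ (Fin d)).image_of_continuousOn
    (continuousOn_infoDensity_diagOp.prodMk continuousOn_optimalFidelity_diagOp)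

theorem exists_infoFidelity_eq_smul {E : Op d} (hE : E.PosSemidef) :
    ∃ k ∈ (fun l : Fin d → ℝ => infoFidelity (diagOp l)) '' stdSimplex ℝ (Fin d),
      infoFidelity E = E.trace.re • k := by
  obtain ⟨V, l, hl, rfl⟩ := exists_diagonalization hE
  rw [infoFidelity_conj V (posSemidef_diagonal_ofReal hl), trace_conj]
  change ∃ k ∈ _, infoFidelity (diagOp l) = (diagOp l).trace.re • k
  rw [trace_diagOp]
  have ht : 0 ≤ ∑ i, l i := Finset.sum_nonneg fun i _ => hl i
  rcases ht.eq_or_lt with h0 | hpos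
  · have hl0 : l = 0 := funext fun i =>
      (Finset.sum_eq_zero_iff_of_nonneg fun i _ => hl i).1 h0.symm i (Finset.mem_univ i)
    -- The zero effect has no normalized spectrum; any point of the simplex serves, as its weight is
    -- zero.
    refine ⟨_, ⟨Pi.single 0 1, single_mem_stdSimplex ℝ 0, rfl⟩, ?_⟩
    have h00 : diagOp l = ((0 : ℝ) : ℂ) • (1 : Op d) := by simp [hl0, diagOp]
    rw [← h0, h00, infoFidelity_smul le_rfl PosSemidef.one, zero_smul, zero_smul]
  · have hl' : (fun i => (∑ i, l i)⁻¹ * l i) ∈ stdSimplex ℝ (Fin d) :=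
      ⟨fun i => mul_nonneg (inv_nonneg.2 ht) (hl i), by
        rw [← Finset.mul_sum, inv_mul_cancel₀ hpos.ne']⟩
    refine ⟨_, ⟨_, hl', rfl⟩, ?_⟩
    rw [← infoFidelity_smul ht (posSemidef_diagOp hl'.1)]
    congr 1
    ext i j
    by_cases hij : i = j
    · subst hij
      simp only [diagOp, Matrix.smul_apply, diagonal_apply_eq, smul_eq_mul]
      rw [← Complex.ofReal_mul, mul_inv_cancel_left₀ hpos.ne']
    · simp [diagOp, hij]

theorem IsPOVM.integral_infoFidelity_mem {X : Type*} [MeasurableSpace X] {ν : Measure X}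
    [SFinite ν] {F : X → Op d} (h : IsPOVM ν F) :
    (d : ℝ)⁻¹ • (information ν F, ∫ x, optimalFidelity (F x) ∂ν) ∈
      convexHull ℝ ((fun l : Fin d → ℝ => infoFidelity (diagOp l)) '' stdSimplex ℝ (Fin d)) := by
  have hint : Integrable (fun x => infoFidelity (F x)) ν :=
    h.integrable_infoDensity.prodMk h.integrable_optimalFidelity
  have hd : (0 : ℝ) < d := Nat.cast_pos.2 (NeZero.pos d)
  have := integral_mem_smul_convexHull isCompact_image_infoFidelity h.integrable_trace hint
    (fun x => (Complex.nonneg_iff.1 (h.posSemidef x).trace_nonneg).1)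
    (fun x => exists_infoFidelity_eq_smul (h.posSemidef x)) (by rwa [h.integral_trace])
  rw [h.integral_trace] at this
  rw [h.information_eq]
  convert this using 2
  exact (integral_pair h.integrable_infoDensity h.integrable_optimalFidelity).symm

theorem infoFidelity_diagOp_perm {l : Fin d → ℝ} (hl : ∀ i, 0 ≤ l i) (σ : Equiv.Perm (Fin d)) :
    infoFidelity (diagOp (l ∘ σ)) = infoFidelity (diagOp l) := by
  rw [← infoFidelity_conj (permUnitary σ) (posSemidef_diagOp hl), permUnitary_conj, diagOp, diagOp,
    submatrix_diagonal _ _ σ.injective]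
  rfl

theorem exists_povm_of_mem_convexHull {q : ℝ × ℝ}
    (hq : q ∈ convexHull ℝ
      ((fun l : Fin d → ℝ => infoFidelity (diagOp l)) '' stdSimplex ℝ (Fin d))) :
    ∃ (n : ℕ) (G : Fin n → Op d), IsPOVM Measure.count G ∧
      information Measure.count G = d * q.1 ∧
      ∫ b, optimalFidelity (G b) ∂Measure.count = d * q.2 := by
  obtain ⟨ι, _, z, w, hz, -, hw, hw1, rfl⟩ := eq_pos_convex_span_of_mem_convexHull hq
  choose l hl hlz using fun i => hz (Set.mem_range_self i)
  -- Addition in `Fin d` is cyclic, so the `d` shifts of a normalized spectrum sum to the identity,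
  -- while each shift has the same information and fidelity. This is the origin of the factor `d`.
  let G : ι × Fin d → Op d := fun b => (w b.1 : ℂ) • diagOp (l b.1 ∘ Equiv.addRight b.2)
  have hpos : ∀ b : ι × Fin d, (diagOp (l b.1 ∘ Equiv.addRight b.2)).PosSemidef := fun b =>
    posSemidef_diagOp fun i => (hl b.1).1 _
  have hGpos : ∀ b, (G b).PosSemidef := fun b =>
    (hpos b).smul (by exact_mod_cast (hw b.1).le)
  have hGsum : ∑ b, G b = 1 := by
    ext i j
    rw [Fintype.sum_prod_type, Matrix.sum_apply]
    simp only [Matrix.sum_apply, G, Matrix.smul_apply, diagOp, smul_eq_mul]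
    by_cases hij : i = j
    · subst hij
      simp only [diagonal_apply_eq, Function.comp_apply, Equiv.coe_addRight, one_apply_eq,
        ← Finset.mul_sum]
      have : ∀ m, ∑ k, (l m (i + k) : ℂ) = 1 := fun m => by
        rw [show ∑ k, (l m (i + k) : ℂ) = ∑ k, (l m k : ℂ) from
          Equiv.sum_comp (Equiv.addLeft i) fun k => (l m k : ℂ), ← Complex.ofReal_sum,
          (hl m).2, Complex.ofReal_one]
      simp only [this, mul_one]
      rw [← Complex.ofReal_sum, hw1, Complex.ofReal_one]
    · simp [hij]
  have hGif : ∀ b, infoFidelity (G b) = w b.1 • z b.1 := fun b => by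
    simp only [G]
    rw [infoFidelity_smul (hw b.1).le (hpos b), infoFidelity_diagOp_perm (hl b.1).1]
    rw [← hlz]
  have hGtot : ∑ b, infoFidelity (G b) = (d : ℝ) • ∑ i, w i • z i := by
    simp only [hGif, Fintype.sum_prod_type, Finset.sum_const, Finset.card_univ, Fintype.card_fin,
      Finset.smul_sum, Nat.cast_smul_eq_nsmul]
  let e := (Fintype.equivFin (ι × Fin d)).symm
  have hpovm : IsPOVM Measure.count (G ∘ e) :=
    isPOVM_count (fun b => hGpos _) (by rw [← hGsum]; exact Equiv.sum_comp e G)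
  refine ⟨_, G ∘ e, hpovm, ?_, ?_⟩
  · rw [information_count_eq hpovm]
    have := congrArg Prod.fst hGtot
    rw [Prod.fst_sum, Prod.smul_fst, smul_eq_mul] at this
    rw [← this]
    exact Equiv.sum_comp e fun b => infoDensity (G b)
  · rw [integral_count]
    have := congrArg Prod.snd hGtot
    rw [Prod.snd_sum, Prod.smul_snd, smul_eq_mul] at this
    rw [← this]
    exact Equiv.sum_comp e fun b => optimalFidelity (G b)

/-- The slice of the compact hull at the prescribed information is compact, and it contains the
point of the given POVM. A point of maximal second coordinate on it is realized by a finite POVM. -/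
theorem exists_optimal_povm {X : Type*} [MeasurableSpace X] {ν : Measure X}
    [SFinite ν] {F : X → Op d} (h : IsPOVM ν F) :
    ∃ (n : ℕ) (G : Fin n → Op d), IsPOVM Measure.count G ∧
      information Measure.count G = information ν F ∧
      ∀ {Y : Type*} [MeasurableSpace Y] (κ : Measure Y) [SFinite κ] (E : Y → Op d),
        IsPOVM κ E → information κ E = information ν F →
        ∫ y, optimalFidelity (E y) ∂κ ≤ ∫ b, optimalFidelity (G b) ∂Measure.count := by
  have hd : (0 : ℝ) < d := Nat.cast_pos.2 (NeZero.pos d)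
  set C := convexHull ℝ
    ((fun l : Fin d → ℝ => infoFidelity (diagOp l)) '' stdSimplex ℝ (Fin d)) with hC
  have hCc : IsCompact C := isCompact_convexHull_of_finrank isCompact_image_infoFidelity
  have hSc : IsCompact (C ∩ {q | q.1 = (d : ℝ)⁻¹ * information ν F}) :=
    hCc.inter_right (isClosed_eq continuous_fst continuous_const)
  obtain ⟨q, ⟨hqC, hq1⟩, hmax⟩ := hSc.exists_isMaxOn
    ⟨_, h.integral_infoFidelity_mem, by simp⟩ continuous_snd.continuousOn
  obtain ⟨n, G, hG, hGi, hGf⟩ := exists_povm_of_mem_convexHull hqC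
  refine ⟨n, G, hG, ?_, fun κ _ E hE hEi => ?_⟩
  · rw [hGi, hq1, mul_inv_cancel_left₀ hd.ne']
  · have h2 := hmax (a := (d : ℝ)⁻¹ • (information κ E, ∫ y, optimalFidelity (E y) ∂κ))
      ⟨hE.integral_infoFidelity_mem, by simp [hEi]⟩
    rw [hGf]
    simpa [inv_mul_le_iff₀ hd] using h2

end Simplex

/-! ### Minimal disturbance and the main theorem. -/

section Main

variable [NeZero d] {X : Type*} [MeasurableSpace X] {ν : Measure X} {F : X → Op d}

theorem IsPOVM.disturbance_twirl [SFinite ν] (h : IsPOVM ν F) :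
    disturbance (twirlMeasure d ν) (sqrtDynamics (QuantumMeasurement.twirl F)) =
      1 - ∫ x, optimalFidelity (F x) ∂ν := by
  rw [h.twirl.disturbance_sqrtDynamics, h.integral_optimalFidelity_twirl]

theorem IsPOVM.isLeast_disturbance [SFinite ν] (h : IsPOVM ν F) :
    IsLeast {D | ∃ 𝒜 : X → Op d → Op d, IsProcedure ν F 𝒜 ∧ D = disturbance ν 𝒜}
      (1 - ∫ x, optimalFidelity (F x) ∂ν) := by
  refine ⟨⟨_, h.isProcedure_sqrtDynamics, h.disturbance_sqrtDynamics.symm⟩, ?_⟩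
  rintro _ ⟨𝒜, h𝒜, rfl⟩
  exact h𝒜.le_disturbance

end Main

end QuantumMeasurement

theorem mainTheorem3 {d : ℕ} [NeZero d] :
    -- every achievable information gain is achieved with minimal disturbance by the square-root
    -- dynamics of the Haar twirl of a finite POVM, and the overall operation is covariant
    (∀ {X : Type*} [MeasurableSpace X] (ν : Measure X) [SigmaFinite ν] (F : X → Op d)
        (𝒜 : X → Op d → Op d), IsProcedure ν F 𝒜 →
      ∃ (n : ℕ) (G : Fin n → Op d),
        IsPOVM Measure.count G ∧
        IsProcedure (twirlMeasure d Measure.count) (twirl G) (sqrtDynamics (twirl G)) ∧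
        information (twirlMeasure d Measure.count) (twirl G) = information ν F ∧
        (∀ {Y : Type*} [MeasurableSpace Y] (κ : Measure Y) [SigmaFinite κ] (E : Y → Op d)
            (ℬ : Y → Op d → Op d), IsProcedure κ E ℬ → information κ E = information ν F →
          disturbance (twirlMeasure d Measure.count) (sqrtDynamics (twirl G)) ≤
            disturbance κ ℬ) ∧
        IsUnitarilyCovariant
          (overallOperation (twirlMeasure d Measure.count) (sqrtDynamics (twirl G))) ∧
        ∃ p ∈ Set.Icc (0 : ℝ) 1,
          overallOperation (twirlMeasure d Measure.count) (sqrtDynamics (twirl G)) =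
            depolarizing p) ∧
    -- for every POVM, the square-root dynamics of its Haar twirl is a covariant procedure with
    -- the same information and with the minimal disturbance, both among the instruments of the
    -- original POVM and among those of the twirled one
    (∀ {X : Type*} [MeasurableSpace X] (ν : Measure X) [SigmaFinite ν] (F : X → Op d),
      IsPOVM ν F →
        IsProcedure (twirlMeasure d ν) (twirl F) (sqrtDynamics (twirl F)) ∧
        information (twirlMeasure d ν) (twirl F) = information ν F ∧
        IsLeast {D | ∃ 𝒜 : X → Op d → Op d, IsProcedure ν F 𝒜 ∧ D = disturbance ν 𝒜}
          (disturbance (twirlMeasure d ν) (sqrtDynamics (twirl F))) ∧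
        IsLeast {D | ∃ 𝒜 : X × UGroup d → Op d → Op d,
            IsProcedure (twirlMeasure d ν) (twirl F) 𝒜 ∧ D = disturbance (twirlMeasure d ν) 𝒜}
          (disturbance (twirlMeasure d ν) (sqrtDynamics (twirl F))) ∧
        IsUnitarilyCovariant
          (overallOperation (twirlMeasure d ν) (sqrtDynamics (twirl F))) ∧
        ∃ p ∈ Set.Icc (0 : ℝ) 1,
          overallOperation (twirlMeasure d ν) (sqrtDynamics (twirl F)) = depolarizing p) ∧
    -- for finite POVMs the information is the mutual information `H(B) - H(B|Ψ)`
    (∀ (n : ℕ) (F : Fin n → Op d), IsPOVM Measure.count F →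
      information Measure.count F = outcomeEntropy F - condOutcomeEntropy F) ∧
    -- the unitarily covariant channels are depolarizing maps
    (∀ 𝒜 : Op d → Op d, IsChannel 𝒜 →
      (IsUnitarilyCovariant 𝒜 ↔
        ∃ p : ℝ, 0 ≤ p ∧ p * ((d : ℝ) ^ 2 - 1) ≤ (d : ℝ) ^ 2 ∧ 𝒜 = depolarizing p)) := by
  refine ⟨?_, ?_, fun n F h => information_eq_outcomeEntropy_sub h,
    fun 𝒜 h => isUnitarilyCovariant_channel_iff h⟩
  · intro X _ ν _ F 𝒜 h
    obtain ⟨n, G, hG, hGi, hopt⟩ := exists_optimal_povm h.povm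
    refine ⟨n, G, hG, hG.twirl.isProcedure_sqrtDynamics, hG.information_twirl.trans hGi, ?_,
      hG.isUnitarilyCovariant_overall_twirl,
      hG.twirl.exists_overallSqrt_eq_depolarizing hG.isUnitarilyCovariant_overall_twirl⟩
    intro Y _ κ _ E ℬ hE hEi
    rw [hG.disturbance_twirl]
    -- Two optimizations combine: over POVMs with the given information, then over instruments for a
    -- given POVM.
    exact (sub_le_sub_left (hopt κ E hE.povm hEi) 1).trans hE.le_disturbance
  · intro X _ ν _ F h
    refine ⟨h.twirl.isProcedure_sqrtDynamics, h.information_twirl, ?_, ?_,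
      h.isUnitarilyCovariant_overall_twirl,
      h.twirl.exists_overallSqrt_eq_depolarizing h.isUnitarilyCovariant_overall_twirl⟩
    · rw [h.disturbance_twirl]
      exact h.isLeast_disturbance
    · rw [h.twirl.disturbance_sqrtDynamics]
      exact h.twirl.isLeast_disturbance
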